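/- Let $L,T>0$, $\Omega=(0,L)$ and $1/2<\alpha<1$. Write $\langle\cdot,\cdot\rangle$ and $\|\cdot\|$ for the inner product and norm of $L_2(\Omega)$, and $\|v\|_1^2=\|v\|^2+\|v_x\|^2$. For $0<t<T$ put $$I^\alpha v(t)=\int_0^t\frac{(t-s)^{\alpha-1}}{\Gamma(\alpha)}\,v(s)\,ds,\qquad \partial_t^{1-\alpha}v=(I^\alpha v)_t .$$ Let $0=x_0<x_1<\cdots<x_P=L$ be a partition and let $\mathbb S_h$ be the space of continuous functions on $[0,L]$ that are affine on each $[x_{p-1},x_p]$ and vanish at $0$ and $L$. Let $F\in W^1_\infty\bigl((0,T);L_\infty(\Omega)\bigr)$ (that is, $F$ and its weak time derivative $F_t$ are essentially bounded on $\Omega\times(0,T)$), let $g,g_*\in L_1\bigl((0,T);L_2(\Omega)\bigr)$ and $u_{0h}\in\mathbb S_h$. Let $u_h:[0,T]\to\mathbb S_h$ be the semi-discrete Galerkin solution, that is, $u_h$ is absolutely continuous, $u_h(0)=u_{0h}$, and for almost every $t\in(0,T)$ and all $v\in\mathbb S_h$, $$\langle u_{ht},v\rangle+\langle\partial_t^{1-\alpha}u_{hx},v_x\rangle-\langle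 F\,\partial_t^{1-\alpha}u_h,v_x\rangle=\langle g(t),v\rangle+\langle g_*(t),v_x\rangle .$$ Assume that, for almost every $t\in(0,T)$, $F_x(\cdot,t)\ge0$ on $\Omega$ in the sense of distributions, and that $1+F(x,t)^2\le C_F$ for almost every $(x,t)\in\Omega\times(0,T)$. Then, for $0<t<T$, $$\|u_h(t)-u_{0h}\|^2\le\frac{t^{1-\alpha}}{(1-\alpha)^2}\int_0^t\Bigl(\tfrac14L^2\|g(s)\|^2+\|g_*(s)\|^2\Bigr)ds+\frac{C_F\,t^\alpha}{(1-\alpha)^2(2\alpha-1)}\,\|u_{0h}\|_1^2,$$ where the right-hand side is allowed to be $+\infty$. -/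

import Mathlib

open MeasureTheory Set
open scoped ContDiff ENNReal

noncomputable section

namespace FracFokkerPlanck

/-- The fractional kernel `ω_α(t) = t^(α-1) / Γ(α)` (used for `t > 0`). -/
def omega (α t : ℝ) : ℝ := t ^ (α - 1) / Real.Gamma α

/-- The fractional integral `I^α v(t) = ∫₀ᵗ ω_α(t-s) v(s) ds`. -/
def fracInt (α : ℝ) (v : ℝ → ℝ) (t : ℝ) : ℝ := ∫ s in (0 : ℝ)..t, omega α (t - s) * v s

/-- The Riemann--Liouville fractional derivative of order `1-α`, namely
`∂_t^{1-α} v = (I^α v)_t`. -/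
def rlDeriv (α : ℝ) (v : ℝ → ℝ) (t : ℝ) : ℝ := deriv (fracInt α v) t

/-- Lebesgue measure on the spatial interval `Ω = (0,L)`. -/
abbrev volΩ (L : ℝ) : Measure ℝ := volume.restrict (Ioo 0 L)

/-- Lebesgue measure on the space-time cylinder, with points written `(t,x)`. -/
abbrev volQ (T L : ℝ) : Measure (ℝ × ℝ) := (volume.restrict (Ioo 0 T)).prod (volΩ L)

/-- The `L₂(Ω)` inner product of two real functions on `Ω = (0,L)`. -/
def ip (L : ℝ) (f g : ℝ → ℝ) : ℝ := ∫ x in (0 : ℝ)..L, f x * g x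

/-- The square of the `H¹(Ω)` norm, `‖v‖₁² = ‖v‖² + ‖v_x‖²`. -/
def h1NormSq (L : ℝ) (v : ℝ → ℝ) : ℝ := ip L v v + ip L (deriv v) (deriv v)

/-- `0 = x₀ < x₁ < ⋯ < x_P = L`. -/
structure IsPartition {P : ℕ} (L : ℝ) (x : Fin (P + 1) → ℝ) : Prop where
  strictMono : StrictMono x
  left : x 0 = 0
  right : x (Fin.last P) = L

/-- Membership in the finite element space `S_h`: continuous functions on `[0,L]` which are
affine on each element `[x_{p-1}, x_p]` and vanish at `0` and `L`.  (Values outside `[0,L]`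
play no role.) -/
structure IsFEFunction {P : ℕ} (L : ℝ) (x : Fin (P + 1) → ℝ) (v : ℝ → ℝ) : Prop where
  continuousOn : ContinuousOn v (Icc 0 L)
  affine : ∀ p : Fin P, ∃ a b : ℝ, ∀ y ∈ Icc (x p.castSucc) (x p.succ), v y = a + b * y
  left : v 0 = 0
  right : v L = 0

/-- `F ∈ W¹_∞((0,T); L_∞(Ω))`: the function `F = F(t,x)` and its weak derivative with respect
to `t` are essentially bounded on the space-time cylinder. -/
def MemW1InfTime (T L : ℝ) (F : ℝ → ℝ → ℝ) : Prop :=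
  MemLp (fun q : ℝ × ℝ => F q.1 q.2) ∞ (volQ T L) ∧
  ∃ D : ℝ × ℝ → ℝ, MemLp D ∞ (volQ T L) ∧
    ∀ φ : ℝ × ℝ → ℝ, ContDiff ℝ ∞ φ → HasCompactSupport φ →
      tsupport φ ⊆ Ioo 0 T ×ˢ Ioo 0 L →
      ∫ q, F q.1 q.2 * fderiv ℝ φ q (1, 0) ∂(volQ T L) = - ∫ q, D q * φ q ∂(volQ T L)

/-- `f_x ≥ 0` on `(0,L)` in the sense of distributions. -/
def WeakDerivNonneg (L : ℝ) (f : ℝ → ℝ) : Prop :=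
  ∀ φ : ℝ → ℝ, ContDiff ℝ ∞ φ → HasCompactSupport φ → tsupport φ ⊆ Ioo 0 L →
    (∀ y, 0 ≤ φ y) → ∫ y in (0 : ℝ)..L, f y * deriv φ y ≤ 0

/-- `u : [0,T] → S_h`, written `u t y`, is the spatially discrete solution with initial value
`u0`: it is absolutely continuous in time (for functions with values in the
finite-dimensional space `S_h` this may be tested pointwise in `y`), and for almost every
`t ∈ (0,T)` and all `v ∈ S_h`,
`⟨u_t, v⟩ + ⟨∂_t^{1-α} u_x, v_x⟩ - ⟨F ∂_t^{1-α} u, v_x⟩ = ⟨g(t), v⟩ + ⟨g_*(t), v_x⟩`. -/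
structure IsSemidiscreteSolution {P : ℕ} (α T L : ℝ) (x : Fin (P + 1) → ℝ)
    (F : ℝ → ℝ → ℝ) (g gs : ℝ → Lp ℝ 2 (volΩ L)) (u0 : ℝ → ℝ) (u : ℝ → ℝ → ℝ) : Prop where
  mem : ∀ t ∈ Icc 0 T, IsFEFunction L x (u t)
  absCont : ∀ y ∈ Icc 0 L, AbsolutelyContinuousOnInterval (fun t => u t y) 0 T
  initial : ∀ y ∈ Icc 0 L, u 0 y = u0 y
  equation : ∀ᵐ t ∂(volume.restrict (Ioo 0 T)), ∀ v : ℝ → ℝ, IsFEFunction L x v →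
    ip L (fun y => deriv (fun s => u s y) t) v
      + ip L (fun y => rlDeriv α (fun s => deriv (u s) y) t) (deriv v)
      - ip L (fun y => F t y * rlDeriv α (fun s => u s y) t) (deriv v)
    = ip L (g t) v + ip L (gs t) (deriv v)

end FracFokkerPlanck

end

/-! The proof is an energy argument with the test function `Z = I^α u_t`, where `u` is the discrete
solution. For absolutely continuous `u` one has `∂_t^{1-α} u = ω_α(t) u₀ + I^α u_t` almost
everywhere (`ae_hasDerivAt_fracInt`), so testing gives `⟨u_t, Z⟩ + ‖Z_x‖² - ⟨F Z, Z_x⟩ = ⟨g, Z⟩ +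
⟨g_*, Z_x⟩ - ω_α ⟨u₀ₓ - F u₀, Z_x⟩`. Since `F_x ≥ 0` and `Z` vanishes at both ends, `⟨F Z, Z_x⟩ = ½
∫ F (Z²)_x ≤ 0` (`IsFEFunction.ip_mul_deriv_nonpos`). The Poincaré inequality with constant `L/2`
and Young's inequality absorb the right side into `‖Z_x‖²` (`energy_inequality`), leaving `⟨u_t, I^α
u_t⟩ ≤ ¼L²‖g‖² + ‖g_*‖² + ½ ω_α² C_F ‖u₀‖₁²`.

Integration in time meets the coercivity bound `t^(α-1) ‖∫₀ᵗ φ‖² ≤ 2Γ(α) ∫₀ᵗ ⟨φ, I^α φ⟩` with `φ =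
u_t` (`rpow_mul_sq_integral_le_fracInt`, `ip_sum_le_integral`). It holds because `|s - r|^(α-1)` is
a positive superposition of the products `1_(a,b)(s) 1_(a,b)(r)`: the energy is a weighted integral
of squares `(∫_a^b φ)²`, and the intervals containing `(0,t]` alone yield the left side. The
constants follow from `1 ≤ Γ(α)` and `2Γ(α) ≤ (1-α)⁻²`.

The coercivity bound requires `u_t` to be square integrable in time, whereas absolute continuity
gives only integrability. For `α > 1/2`, however, `I^α` maps `L₁` into `L₂` and `ω_α ∈ L₂`, so the
Galerkin equation itself places the coefficients of `u_t` in `L₂` once the data are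
(`exists_abs_coeff_le`). -/

namespace FracFokkerPlanck

/-! ### The fractional kernel and the fractional integral as a convolution -/

/-- The fractional kernel cut off to `(0, T]`. -/
noncomputable def kern (α T : ℝ) : ℝ → ℝ := (Ioc 0 T).indicator (omega α)

lemma omega_nonneg {α t : ℝ} (hα : 0 < α) (ht : 0 ≤ t) : 0 ≤ omega α t :=
  div_nonneg (Real.rpow_nonneg ht _) (Real.Gamma_pos_of_pos hα).le

lemma measurable_omega (α : ℝ) : Measurable (omega α) := by
  unfold omega
  fun_prop

lemma measurable_kern (α T : ℝ) : Measurable (kern α T) :=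
  (measurable_omega α).indicator measurableSet_Ioc

lemma kern_nonneg {α : ℝ} (hα : 0 < α) (T s : ℝ) : 0 ≤ kern α T s :=
  indicator_nonneg (fun _ hs => omega_nonneg hα hs.1.le) s

lemma intervalIntegrable_omega {α : ℝ} (hα : 0 < α) (a b : ℝ) :
    IntervalIntegrable (omega α) volume a b :=
  (intervalIntegral.intervalIntegrable_rpow' (by linarith)).div_const _

lemma integral_omega {α : ℝ} (hα : 0 < α) (t : ℝ) :
    ∫ s in (0 : ℝ)..t, omega α s = t ^ α / (α * Real.Gamma α) := by
  unfold omega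
  rw [intervalIntegral.integral_div, integral_rpow (Or.inl (by linarith))]
  simp [Real.zero_rpow hα.ne', div_div]

lemma integrable_kern {α T : ℝ} (hα : 0 < α) (hT : 0 ≤ T) : Integrable (kern α T) := by
  rw [kern, integrable_indicator_iff measurableSet_Ioc,
    ← intervalIntegrable_iff_integrableOn_Ioc_of_le hT]
  exact intervalIntegrable_omega hα 0 T

lemma integrableOn_omega_sq {α T : ℝ} (hα : 1 / 2 < α) (hT : 0 ≤ T) :
    IntegrableOn (fun s => omega α s ^ 2) (Ioc 0 T) := by
  have h : IntervalIntegrable (fun s : ℝ => s ^ (2 * α - 2) / Real.Gamma α ^ 2) volume 0 T :=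
    (intervalIntegral.intervalIntegrable_rpow' (by linarith)).div_const _
  rw [intervalIntegrable_iff_integrableOn_Ioc_of_le hT] at h
  refine h.congr_fun (fun s hs => ?_) measurableSet_Ioc
  simp only [omega, div_pow]
  rw [← Real.rpow_natCast (s ^ (α - 1)) 2, ← Real.rpow_mul hs.1.le]
  congr 2
  push_cast
  ring

lemma integral_omega_sq {α t : ℝ} (hα : 1 / 2 < α) (ht : 0 ≤ t) :
    ∫ s in Ioc 0 t, omega α s ^ 2 = t ^ (2 * α - 1) / ((2 * α - 1) * Real.Gamma α ^ 2) := by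
  have h : ∀ s ∈ Ioc 0 t, omega α s ^ 2 = s ^ (2 * α - 2) / Real.Gamma α ^ 2 := fun s hs => by
    simp only [omega, div_pow]
    rw [← Real.rpow_natCast (s ^ (α - 1)) 2, ← Real.rpow_mul hs.1.le]
    congr 2
    push_cast
    ring
  rw [setIntegral_congr_fun measurableSet_Ioc h, ← intervalIntegral.integral_of_le ht,
    intervalIntegral.integral_div, integral_rpow (Or.inl (by linarith)),
    Real.zero_rpow (by linarith), show 2 * α - 2 + 1 = 2 * α - 1 by ring]
  simp [div_div]

/-- The exponent of `ω_α²` is `2α - 2`, which exceeds `-1` precisely when `α > 1/2`. -/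
lemma memLp_omega {α T : ℝ} (hα : 1 / 2 < α) (hT : 0 ≤ T) :
    MemLp (omega α) 2 (volume.restrict (Ioc 0 T)) :=
  (memLp_two_iff_integrable_sq (measurable_omega α).aestronglyMeasurable).2
    (integrableOn_omega_sq hα hT)

lemma memLp_kern {α T : ℝ} (hα : 1 / 2 < α) (hT : 0 ≤ T) : MemLp (kern α T) 2 := by
  rw [kern, memLp_indicator_iff_restrict measurableSet_Ioc]
  exact memLp_omega hα hT

/-- The fractional integral as a convolution on the line. -/
lemma fracInt_eq_integral {α T t : ℝ} (φ : ℝ → ℝ) (ht : 0 ≤ t) (htT : t ≤ T) :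
    fracInt α φ t = ∫ r, kern α T (t - r) * (Ioc 0 T).indicator φ r := by
  -- The endpoint `r = t` is discarded because `kern` is cut off at `0`.
  rw [fracInt, intervalIntegral.integral_of_le ht, integral_Ioc_eq_integral_Ioo,
    ← integral_indicator measurableSet_Ioo]
  congr 1
  ext r
  by_cases hr : r ∈ Ioo 0 t
  · have h1 : t - r ∈ Ioc 0 T := ⟨by linarith [hr.2], by linarith [hr.1]⟩
    have h2 : r ∈ Ioc 0 T := ⟨hr.1, by linarith [hr.2]⟩
    simp [kern, hr, h1, h2, -mem_Ioo, -mem_Ioc]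
  · rw [indicator_of_notMem hr]
    by_cases h2 : r ∈ Ioc 0 T
    · have h1 : t - r ∉ Ioc 0 T := fun h => hr ⟨h2.1, by linarith [h.1]⟩
      simp [kern, h1, -mem_Ioc]
    · simp [h2, -mem_Ioc]

lemma fracInt_eq_integral' {α T t : ℝ} (φ : ℝ → ℝ) (ht : 0 ≤ t) (htT : t ≤ T) :
    fracInt α φ t = ∫ r, kern α T r * (Ioc 0 T).indicator φ (t - r) := by
  rw [fracInt_eq_integral φ ht htT,
    ← integral_sub_left_eq_self (fun r => kern α T r * (Ioc 0 T).indicator φ (t - r)) volume t]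
  simp

lemma fracInt_congr_ae {α T t : ℝ} {φ ψ : ℝ → ℝ}
    (h : φ =ᵐ[volume.restrict (Ioc 0 T)] ψ) (ht : 0 ≤ t) (htT : t ≤ T) :
    fracInt α φ t = fracInt α ψ t := by
  refine intervalIntegral.integral_congr_ae ?_
  rw [Filter.EventuallyEq, ae_restrict_iff' measurableSet_Ioc] at h
  filter_upwards [h] with s hs hs'
  rw [uIoc_of_le ht] at hs'
  rw [hs ⟨hs'.1, hs'.2.trans htT⟩]

lemma integrable_kern_mul {α T : ℝ} (hα : 0 < α) (hT : 0 ≤ T) {φ : ℝ → ℝ}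
    (hφ : IntegrableOn φ (Ioc 0 T)) :
    Integrable (fun p : ℝ × ℝ => kern α T p.2 * (Ioc 0 T).indicator φ (p.1 - p.2))
      (volume.prod volume) :=
  (integrable_kern hα hT).convolution_integrand (ContinuousLinearMap.mul ℝ ℝ)
    ((integrable_indicator_iff measurableSet_Ioc).2 hφ)

lemma integrable_mul_kern {α T : ℝ} (hα : 0 < α) (hT : 0 ≤ T) {φ : ℝ → ℝ}
    (hφ : IntegrableOn φ (Ioc 0 T)) :
    Integrable (fun p : ℝ × ℝ => kern α T (p.1 - p.2) * (Ioc 0 T).indicator φ p.2)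
      (volume.prod volume) := by
  have := ((integrable_indicator_iff measurableSet_Ioc).2 hφ).convolution_integrand
    (ContinuousLinearMap.mul ℝ ℝ) (integrable_kern hα hT) (μ := volume)
  simpa [mul_comm] using this

lemma integrableOn_fracInt {α T : ℝ} (hα : 0 < α) (hT : 0 ≤ T) {φ : ℝ → ℝ}
    (hφ : IntegrableOn φ (Ioc 0 T)) : IntegrableOn (fracInt α φ) (Ioc 0 T) :=
  (integrable_mul_kern hα hT hφ).integral_prod_left.integrableOn.congr_fun
    (fun _ hs => (fracInt_eq_integral φ hs.1.le hs.2).symm) measurableSet_Ioc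

/-! ### The Riemann–Liouville derivative of an absolutely continuous function -/

/-- Fractional integration commutes with taking primitives. -/
lemma fracInt_primitive {α T t : ℝ} (hα : 0 < α) {φ : ℝ → ℝ}
    (hφ : IntegrableOn φ (Ioc 0 T)) (ht : 0 ≤ t) (htT : t ≤ T) :
    fracInt α (fun s => ∫ r in (0 : ℝ)..s, φ r) t = ∫ s in (0 : ℝ)..t, fracInt α φ s := by
  have hT : 0 ≤ T := ht.trans htT
  have hR : ∫ s in (0 : ℝ)..t, fracInt α φ s =
      ∫ s in Ioc 0 t, ∫ r, kern α T r * (Ioc 0 T).indicator φ (s - r) := by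
    rw [intervalIntegral.integral_of_le ht]
    exact setIntegral_congr_fun measurableSet_Ioc
      fun s hs => fracInt_eq_integral' φ hs.1.le (hs.2.trans htT)
  -- After Fubini, the inner integral of the cut-off `φ (s - r)` over `s ∈ (0,t]` is the primitive
  -- of `φ` at `t - r`, and is zero when `r ≥ t`.
  rw [hR, integral_integral_swap, fracInt_eq_integral' _ ht htT]
  · congr 1
    ext r
    rw [integral_const_mul]
    by_cases hr : r ∈ Ioc 0 T
    · congr 1
      rw [← intervalIntegral.integral_of_le ht,
        intervalIntegral.integral_comp_sub_right (fun s => (Ioc 0 T).indicator φ s) r]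
      rw [intervalIntegral.integral_of_le (by linarith), setIntegral_indicator measurableSet_Ioc]
      by_cases hrt : r < t
      · have h1 : t - r ∈ Ioc 0 T := ⟨by linarith, by linarith [hr.1]⟩
        rw [indicator_of_mem h1, intervalIntegral.integral_of_le h1.1.le]
        congr 2
        ext s
        simp only [mem_Ioc, mem_inter_iff]
        constructor
        · rintro ⟨h2, h3⟩
          exact ⟨⟨by linarith [hr.1], h3⟩, h2, by linarith [h1.2]⟩
        · rintro ⟨⟨h2, h3⟩, h4, h5⟩
          exact ⟨h4, h3⟩
      · have h1 : t - r ∉ Ioc 0 T := fun h => by linarith [h.1]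
        rw [indicator_of_notMem h1]
        have : Ioc (0 - r) (t - r) ∩ Ioc 0 T = ∅ := by
          ext s
          simp only [mem_Ioc, mem_inter_iff, mem_empty_iff_false, iff_false]
          rintro ⟨⟨h2, h3⟩, h4, h5⟩
          linarith
        rw [this]
        simp
    · simp [kern, hr, -mem_Ioc]
  · have := integrable_kern_mul hα hT hφ
    refine this.mono_measure ?_
    exact Measure.prod_mono Measure.restrict_le_self le_rfl

/-- The Riemann--Liouville derivative of an absolutely continuous function exists almost
everywhere and is given by the fractional integral of the derivative. -/
lemma ae_hasDerivAt_fracInt {α T : ℝ} (hα : 0 < α) {W : ℝ → ℝ}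
    (hT : 0 ≤ T) (hW : AbsolutelyContinuousOnInterval W 0 T) :
    ∀ᵐ t ∂(volume.restrict (Ioo 0 T)),
      HasDerivAt (fracInt α W) (W 0 * omega α t + fracInt α (deriv W) t) t := by
  have hd : IntegrableOn (deriv W) (Ioc 0 T) := by
    rw [← intervalIntegrable_iff_integrableOn_Ioc_of_le hT]
    exact hW.intervalIntegrable_deriv
  have hI := integrableOn_fracInt hα hT hd
  rw [← intervalIntegrable_iff_integrableOn_Ioc_of_le hT] at hI
  rw [ae_restrict_iff' measurableSet_Ioo]
  -- Lebesgue differentiation of the primitive of `I^α W'`. Near such a `t`, `I^α W` equals this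
  -- primitive plus `W 0` times `I^α 1 = t^α / (α Γ(α))`.
  filter_upwards [hI.ae_hasDerivAt_integral] with t ht htT
  have h1 := ht (by rw [uIcc_of_le hT]; exact Ioo_subset_Icc_self htT) 0
    (by rw [uIcc_of_le hT]; exact ⟨le_rfl, hT⟩)
  have h2 : HasDerivAt (fun s : ℝ => W 0 * (s ^ α / (α * Real.Gamma α)))
      (W 0 * omega α t) t := by
    refine HasDerivAt.const_mul _ ?_
    have h3 := (Real.hasDerivAt_rpow_const (x := t) (p := α) (Or.inl htT.1.ne')).div_const
      (α * Real.Gamma α)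
    rwa [mul_div_mul_left _ _ hα.ne'] at h3
  refine (h2.add h1).congr_of_eventuallyEq ?_
  filter_upwards [Ioo_mem_nhds htT.1 htT.2] with s hs
  have hWs : ∀ r ∈ Icc 0 T, W r = W 0 + ∫ q in (0 : ℝ)..r, deriv W q := by
    intro r hr
    have : AbsolutelyContinuousOnInterval W 0 r := hW.mono (by
      rw [uIcc_of_le hr.1, uIcc_of_le hT]
      exact Icc_subset_Icc_right hr.2)
    rw [this.integral_deriv_eq_sub]
    ring
  have hsI : IntervalIntegrable (fun r => omega α (s - r)) volume 0 s := by
    have := (intervalIntegrable_omega hα s 0).comp_sub_left s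
    simpa using this
  have e1 : fracInt α W s = fracInt α (fun r => W 0 + ∫ q in (0 : ℝ)..r, deriv W q) s := by
    refine fracInt_congr_ae (T := T) ?_ hs.1.le hs.2.le
    filter_upwards [ae_restrict_mem measurableSet_Ioc] with r hr
    exact hWs r (Ioc_subset_Icc_self hr)
  rw [e1, Pi.add_apply, ← fracInt_primitive hα hd hs.1.le hs.2.le]
  unfold fracInt
  simp_rw [mul_add]
  have hc : ContinuousOn (fun r => ∫ q in (0 : ℝ)..r, deriv W q) (uIcc 0 s) := by
    refine (hW.continuousOn.mono ?_).sub continuousOn_const |>.congr (f := fun r => W r - W 0) ?_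
    · rw [uIcc_of_le hs.1.le, uIcc_of_le hT]
      exact Icc_subset_Icc_right hs.2.le
    · intro r hr
      rw [uIcc_of_le hs.1.le] at hr
      have := hWs r ⟨hr.1, hr.2.trans hs.2.le⟩
      simp only
      linarith
  rw [intervalIntegral.integral_add (hsI.mul_const _) (hsI.mul_continuousOn hc),
    intervalIntegral.integral_mul_const,
    intervalIntegral.integral_comp_sub_left (fun r => omega α r) s, sub_self, sub_zero,
    integral_omega hα, mul_comm (W 0)]

/-! ### Mapping the fractional integral from `L₁` to `L₂` -/

/-- Cauchy--Schwarz for a product with a weight. -/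
lemma sq_lintegral_mul_le {X : Type*} [MeasurableSpace X] (μ : Measure X) {k w : X → ℝ≥0∞}
    (hk : AEMeasurable k μ) (hw : AEMeasurable w μ) :
    (∫⁻ a, k a * w a ∂μ) ^ 2 ≤ (∫⁻ a, w a ∂μ) * ∫⁻ a, k a ^ 2 * w a ∂μ := by
  -- Hölder with exponents `2, 2` for the splitting `k w = w^(1/2) · (k w^(1/2))`.
  have h := ENNReal.lintegral_mul_le_Lp_mul_Lq μ Real.HolderConjugate.two_two
    (f := fun a => w a ^ (1 / 2 : ℝ)) (g := fun a => k a * w a ^ (1 / 2 : ℝ))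
    (hw.pow_const _) (hk.mul (hw.pow_const _))
  have hs : ∀ c : ℝ≥0∞, c ^ (1 / 2 : ℝ) * c ^ (1 / 2 : ℝ) = c := fun c => by
    rw [← ENNReal.rpow_add_of_nonneg _ _ (by norm_num) (by norm_num)]
    norm_num
  have hs' : ∀ c : ℝ≥0∞, (c ^ (1 / 2 : ℝ)) ^ 2 = c := fun c => by rw [sq, hs]
  simp only [Pi.mul_apply] at h
  have e1 : ∀ a, w a ^ (1 / 2 : ℝ) * (k a * w a ^ (1 / 2 : ℝ)) = k a * w a := fun a => by
    rw [mul_left_comm, hs]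
  have e2 : ∀ a, (w a ^ (1 / 2 : ℝ)) ^ (2 : ℝ) = w a := fun a => by
    rw [ENNReal.rpow_two, hs']
  have e3 : ∀ a, (k a * w a ^ (1 / 2 : ℝ)) ^ (2 : ℝ) = k a ^ 2 * w a := fun a => by
    rw [ENNReal.rpow_two, mul_pow, hs']
  simp only [e1, e2, e3] at h
  calc (∫⁻ a, k a * w a ∂μ) ^ 2
      ≤ ((∫⁻ a, w a ∂μ) ^ (1 / 2 : ℝ) * (∫⁻ a, k a ^ 2 * w a ∂μ) ^ (1 / 2 : ℝ)) ^ 2 := by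
        gcongr
    _ = _ := by rw [mul_pow, hs', hs']

/-- For `α > 1/2` the fractional integral maps `L₁(0,T)` into `L₂(0,T)`. -/
lemma memLp_fracInt {α T : ℝ} (hα : 1 / 2 < α) (hT : 0 ≤ T) {φ : ℝ → ℝ}
    (hφ : IntegrableOn φ (Ioc 0 T)) : MemLp (fracInt α φ) 2 (volume.restrict (Ioc 0 T)) := by
  have hα0 : 0 < α := by linarith
  have hm := (integrableOn_fracInt hα0 hT hφ).aestronglyMeasurable
  set ψ := (Ioc 0 T).indicator φ with hψ
  have hψi : Integrable ψ := (integrable_indicator_iff measurableSet_Ioc).2 hφ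
  have hk := memLp_kern hα hT
  have hkfin : ∫⁻ r, ‖kern α T r‖ₑ ^ 2 < ⊤ := by
    have := (memLp_two_iff_integrable_sq hk.1).1 hk |>.hasFiniteIntegral
    simpa [HasFiniteIntegral, enorm_pow] using this
  refine (memLp_two_iff_integrable_sq hm).2 ⟨hm.pow 2, ?_⟩
  rw [HasFiniteIntegral]
  have hkm : Measurable fun p : ℝ × ℝ => ‖kern α T (p.1 - p.2)‖ₑ :=
    ((measurable_kern α T).comp (measurable_fst.sub measurable_snd)).enorm
  -- Young's convolution inequality by hand: Cauchy–Schwarz with weight `|ψ|`, then Tonelli and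
  -- translation invariance, bound the integral by `‖ψ‖₁² ‖kern‖₂²`.
  calc ∫⁻ s in Ioc 0 T, ‖fracInt α φ s ^ 2‖ₑ
      ≤ ∫⁻ s in Ioc 0 T, (∫⁻ r, ‖ψ r‖ₑ) * ∫⁻ r, ‖kern α T (s - r)‖ₑ ^ 2 * ‖ψ r‖ₑ := by
        refine setLIntegral_mono' measurableSet_Ioc fun s hs => ?_
        rw [fracInt_eq_integral φ hs.1.le hs.2, enorm_pow]
        calc _ ≤ (∫⁻ r, ‖kern α T (s - r)‖ₑ * ‖ψ r‖ₑ) ^ 2 := by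
              gcongr
              refine (enorm_integral_le_lintegral_enorm _).trans_eq ?_
              simp_rw [enorm_mul]
              rfl
          _ ≤ _ := sq_lintegral_mul_le _
            ((measurable_kern α T).comp (measurable_const.sub measurable_id)).enorm.aemeasurable
            hψi.1.enorm
    _ ≤ ∫⁻ s, (∫⁻ r, ‖ψ r‖ₑ) * ∫⁻ r, ‖kern α T (s - r)‖ₑ ^ 2 * ‖ψ r‖ₑ :=
        setLIntegral_le_lintegral _ _
    _ = (∫⁻ r, ‖ψ r‖ₑ) * ∫⁻ s, ∫⁻ r, ‖kern α T (s - r)‖ₑ ^ 2 * ‖ψ r‖ₑ := by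
        rw [lintegral_const_mul' _ _ hψi.2.ne]
    _ = (∫⁻ r, ‖ψ r‖ₑ) * ∫⁻ r, ∫⁻ s, ‖kern α T (s - r)‖ₑ ^ 2 * ‖ψ r‖ₑ := by
        rw [lintegral_lintegral_swap]
        exact (hkm.pow_const 2).aemeasurable.mul hψi.1.comp_snd.enorm
    _ = (∫⁻ r, ‖ψ r‖ₑ) * ∫⁻ r, (∫⁻ s, ‖kern α T s‖ₑ ^ 2) * ‖ψ r‖ₑ := by
        congr 2
        ext r
        have hkr : Measurable fun s => ‖kern α T (s - r)‖ₑ ^ 2 :=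
          ((measurable_kern α T).comp (measurable_id.sub measurable_const)).enorm.pow_const 2
        rw [lintegral_mul_const _ hkr]
        congr 1
        exact lintegral_sub_right_eq_self (fun s => ‖kern α T s‖ₑ ^ 2) r
    _ = (∫⁻ r, ‖ψ r‖ₑ) * ((∫⁻ s, ‖kern α T s‖ₑ ^ 2) * ∫⁻ r, ‖ψ r‖ₑ) := by
        rw [lintegral_const_mul' _ _ hkfin.ne]
    _ < ⊤ := ENNReal.mul_lt_top hψi.2 (ENNReal.mul_lt_top hkfin hψi.2)

/-! ### The Riesz kernel as a mixture of intervals, and coercivity -/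

lemma lintegral_Ioi_rpow {β p : ℝ} (hβ : β < -1) (hp : 0 < p) :
    ∫⁻ s in Ioi p, ENNReal.ofReal (s ^ β) = ENNReal.ofReal (p ^ (β + 1) / (-(β + 1))) := by
  rw [← ofReal_integral_eq_lintegral_ofReal (integrableOn_Ioi_rpow_of_lt hβ hp)]
  · rw [integral_Ioi_rpow_of_lt hβ hp, div_neg, neg_div]
  · filter_upwards [ae_restrict_mem measurableSet_Ioi] with s hs
    exact Real.rpow_nonneg (hp.trans hs).le _

lemma lintegral_Ioi_sub_rpow {β a M : ℝ} (hβ : β < -1) (h : a < M) :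
    ∫⁻ b in Ioi M, ENNReal.ofReal (|b - a| ^ β) =
      ENNReal.ofReal ((M - a) ^ (β + 1) / (-(β + 1))) := by
  rw [← lintegral_Ioi_rpow hβ (sub_pos.2 h), ← lintegral_indicator measurableSet_Ioi,
    ← lintegral_indicator measurableSet_Ioi,
    ← lintegral_sub_right_eq_self ((Ioi (M - a)).indicator fun s => ENNReal.ofReal (s ^ β)) a]
  congr 1
  ext b
  by_cases hb : M < b
  · rw [indicator_of_mem (show b ∈ Ioi M from hb),
      indicator_of_mem (show b - a ∈ Ioi (M - a) from sub_lt_sub_right hb a),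
      abs_of_pos (by linarith)]
  · rw [indicator_of_notMem (show b ∉ Ioi M from hb),
      indicator_of_notMem (show b - a ∉ Ioi (M - a) from fun h => hb (by simpa using h))]

lemma lintegral_Iio_sub_rpow {β m M : ℝ} (hβ : β < -1) (h : m < M) :
    ∫⁻ a in Iio m, ENNReal.ofReal (|M - a| ^ β) =
      ENNReal.ofReal ((M - m) ^ (β + 1) / (-(β + 1))) := by
  rw [← lintegral_Ioi_rpow hβ (sub_pos.2 h), ← lintegral_indicator measurableSet_Iio,
    ← lintegral_indicator measurableSet_Ioi,
    ← lintegral_sub_left_eq_self ((Ioi (M - m)).indicator fun s => ENNReal.ofReal (s ^ β)) M]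
  congr 1
  ext a
  by_cases ha : a < m
  · rw [indicator_of_mem (show a ∈ Iio m from ha),
      indicator_of_mem (show M - a ∈ Ioi (M - m) from sub_lt_sub_left ha M),
      abs_of_pos (by linarith)]
  · rw [indicator_of_notMem (show a ∉ Iio m from ha),
      indicator_of_notMem (show M - a ∉ Ioi (M - m) from fun h => ha (by simpa using h))]

/-- The weight that represents the kernel `|s - r| ^ (α - 1)` as a superposition of products of
indicator functions of intervals. -/
noncomputable def mixWeight (α : ℝ) (p : ℝ × ℝ) : ℝ :=
  (1 - α) * (2 - α) * |p.2 - p.1| ^ (α - 3)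

lemma mixWeight_nonneg {α : ℝ} (hα : α < 1) (p : ℝ × ℝ) : 0 ≤ mixWeight α p :=
  mul_nonneg (mul_nonneg (by linarith) (by linarith)) (Real.rpow_nonneg (abs_nonneg _) _)

lemma measurable_mixWeight (α : ℝ) : Measurable (mixWeight α) := by
  unfold mixWeight
  fun_prop

/-- Integrating the power `α - 3` first in `b`, then in `a`, produces the denominators `2 - α` and
`1 - α`; the prefactor of `mixWeight` is chosen to cancel them. -/
lemma setLIntegral_mixWeight {α m M : ℝ} (hα : α < 1) (h : m < M) :
    ∫⁻ p in Iio m ×ˢ Ioi M, ENNReal.ofReal (mixWeight α p) =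
      ENNReal.ofReal ((M - m) ^ (α - 1)) := by
  have h1 : 0 < 1 - α := by linarith
  have h2 : 0 < 2 - α := by linarith
  rw [Measure.volume_eq_prod, ← Measure.prod_restrict,
    lintegral_prod _ (measurable_mixWeight α).ennreal_ofReal.aemeasurable]
  calc ∫⁻ a in Iio m, ∫⁻ b in Ioi M, ENNReal.ofReal (mixWeight α (a, b))
      = ∫⁻ a in Iio m, ENNReal.ofReal (1 - α) * ENNReal.ofReal (|M - a| ^ (α - 2)) := by
        refine setLIntegral_congr_fun measurableSet_Iio fun a ha => ?_
        have ha' : a < M := lt_trans ha h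
        simp only [mixWeight]
        simp_rw [ENNReal.ofReal_mul (mul_pos h1 h2).le]
        rw [lintegral_const_mul' _ _ ENNReal.ofReal_ne_top,
          lintegral_Ioi_sub_rpow (by linarith) ha', ← ENNReal.ofReal_mul (mul_pos h1 h2).le,
          ← ENNReal.ofReal_mul h1.le, abs_of_pos (sub_pos.2 ha')]
        congr 1
        rw [show α - 3 + 1 = α - 2 by ring, neg_sub]
        field_simp
    _ = _ := by
        rw [lintegral_const_mul' _ _ ENNReal.ofReal_ne_top,
          lintegral_Iio_sub_rpow (by linarith) h, ← ENNReal.ofReal_mul h1.le]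
        congr 1
        rw [show α - 2 + 1 = α - 1 by ring, neg_sub]
        field_simp

/-- An interval `(a,b)` contains both points exactly when `a < min s r` and `b > max s r`, so the
integral reduces to a quadrant. Pairs with `a ≥ b` give an empty interval and contribute nothing. -/
lemma lintegral_indicator_mixWeight {α s r : ℝ} (hα : α < 1) (h : s ≠ r) :
    ∫⁻ p : ℝ × ℝ, ENNReal.ofReal ((Ioo p.1 p.2).indicator 1 s * (Ioo p.1 p.2).indicator 1 r
        * mixWeight α p) = ENNReal.ofReal (|s - r| ^ (α - 1)) := by
  have hlt : min s r < max s r := min_lt_max.2 h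
  rw [abs_sub_comm, ← max_sub_min_eq_abs, ← setLIntegral_mixWeight hα hlt,
    ← lintegral_indicator (measurableSet_Iio.prod measurableSet_Ioi)]
  congr 1
  ext ⟨a, b⟩
  by_cases hp : (a, b) ∈ Iio (min s r) ×ˢ Ioi (max s r)
  · rw [indicator_of_mem hp]
    simp only [mem_prod, mem_Iio, mem_Ioi, lt_min_iff, max_lt_iff] at hp
    simp [indicator, hp]
  · rw [indicator_of_notMem hp]
    simp only [mem_prod, mem_Iio, mem_Ioi, lt_min_iff, max_lt_iff] at hp
    by_cases hs : s ∈ Ioo a b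
    · have hr : r ∉ Ioo a b := fun hr => hp ⟨⟨hs.1, hr.1⟩, hs.2, hr.2⟩
      simp [indicator_of_notMem hr]
    · simp [indicator_of_notMem hs]

lemma measurable_indicator_Ioo_prod :
    Measurable fun q : ℝ × (ℝ × ℝ) => (Ioo q.2.1 q.2.2).indicator (1 : ℝ → ℝ) q.1 := by
  have : (fun q : ℝ × (ℝ × ℝ) => (Ioo q.2.1 q.2.2).indicator (1 : ℝ → ℝ) q.1) =
      {q : ℝ × (ℝ × ℝ) | q.2.1 < q.1 ∧ q.1 < q.2.2}.indicator 1 := by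
    ext q
    simp [indicator, mem_Ioo]
  rw [this]
  refine measurable_one.indicator (MeasurableSet.inter ?_ ?_)
  · exact measurableSet_lt (measurable_fst.comp measurable_snd) measurable_fst
  · exact measurableSet_lt measurable_fst (measurable_snd.comp measurable_snd)

/-- A lower bound for the energy of the Riesz kernel on an interval. -/
lemma rpow_mul_sq_integral_le {α t : ℝ} (hα' : α < 1) (ht : 0 < t) {ψ : ℝ → ℝ}
    (hψ : Integrable ψ) (hsupp : ∀ s, s ∉ Ioc 0 t → ψ s = 0)
    (hH : Integrable fun q : ℝ × ℝ => ψ q.1 * ψ q.2 * |q.1 - q.2| ^ (α - 1)) :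
    t ^ (α - 1) * (∫ s, ψ s) ^ 2 ≤ ∫ q : ℝ × ℝ, ψ q.1 * ψ q.2 * |q.1 - q.2| ^ (α - 1) := by
  set e : ℝ → ℝ × ℝ → ℝ := fun s p => (Ioo p.1 p.2).indicator (1 : ℝ → ℝ) s with he
  set G : (ℝ × ℝ) × (ℝ × ℝ) → ℝ := fun z =>
    ψ z.1.1 * ψ z.1.2 * (e z.1.1 z.2 * e z.1.2 z.2 * mixWeight α z.2) with hG
  have he0 : ∀ s p, 0 ≤ e s p := fun s p => indicator_nonneg (fun _ _ => zero_le_one) s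
  -- The diagonal must be excluded: there the mixture integral diverges, while `0 ^ (α - 1)` has the
  -- default value `0`.
  have hne : ∀ᵐ q : ℝ × ℝ, q.1 ≠ q.2 := by
    rw [Measure.volume_eq_prod, Measure.ae_prod_iff_ae_ae]
    · refine Filter.Eventually.of_forall fun s => ?_
      have : ∀ᵐ r : ℝ, r ≠ s := by simp [ae_iff, measure_singleton]
      filter_upwards [this] with r hr using hr.symm
    · exact (measurableSet_eq_fun measurable_fst measurable_snd).compl
  have hKm : Measurable fun z : (ℝ × ℝ) × (ℝ × ℝ) =>
      e z.1.1 z.2 * e z.1.2 z.2 * mixWeight α z.2 := by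
    refine Measurable.mul (Measurable.mul ?_ ?_) ((measurable_mixWeight α).comp measurable_snd)
    · exact measurable_indicator_Ioo_prod.comp
        ((measurable_fst.comp measurable_fst).prodMk measurable_snd)
    · exact measurable_indicator_Ioo_prod.comp
        ((measurable_snd.comp measurable_fst).prodMk measurable_snd)
  have hψψ : AEStronglyMeasurable (fun q : ℝ × ℝ => ψ q.1 * ψ q.2) :=
    hψ.1.comp_fst.mul hψ.1.comp_snd
  have hGm : AEStronglyMeasurable G (volume.prod volume) :=
    (hψψ.comp_fst (ν := volume)).mul hKm.aestronglyMeasurable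
  have hK0 : ∀ (q : ℝ × ℝ) (p : ℝ × ℝ), 0 ≤ e q.1 p * e q.2 p * mixWeight α p := fun q p =>
    mul_nonneg (mul_nonneg (he0 _ _) (he0 _ _)) (mixWeight_nonneg hα' p)
  have hinner : ∀ q : ℝ × ℝ, q.1 ≠ q.2 →
      ∫⁻ p, ENNReal.ofReal (e q.1 p * e q.2 p * mixWeight α p) =
        ENNReal.ofReal (|q.1 - q.2| ^ (α - 1)) :=
    fun q hq => lintegral_indicator_mixWeight hα' hq
  have hGi : Integrable G (volume.prod volume) := by
    refine ⟨hGm, ?_⟩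
    rw [HasFiniteIntegral, lintegral_prod _ hGm.enorm]
    have : ∫⁻ q : ℝ × ℝ, ∫⁻ p : ℝ × ℝ, ‖G (q, p)‖ₑ =
        ∫⁻ q : ℝ × ℝ, ‖ψ q.1 * ψ q.2 * |q.1 - q.2| ^ (α - 1)‖ₑ := by
      refine lintegral_congr_ae ?_
      filter_upwards [hne] with q hq
      simp only [hG]
      simp_rw [enorm_mul (ψ q.1 * ψ q.2)]
      rw [lintegral_const_mul' _ _ enorm_ne_top]
      congr 1
      rw [Real.enorm_of_nonneg (Real.rpow_nonneg (abs_nonneg _) _), ← hinner q hq]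
      exact lintegral_congr fun p => Real.enorm_of_nonneg (hK0 q p)
    rw [this]
    exact hH.2
  have h1 : ∫ q : ℝ × ℝ, ψ q.1 * ψ q.2 * |q.1 - q.2| ^ (α - 1) = ∫ q, ∫ p, G (q, p) := by
    refine integral_congr_ae ?_
    filter_upwards [hne] with q hq
    simp only [hG]
    rw [integral_const_mul]
    congr 1
    rw [integral_eq_lintegral_of_nonneg_ae (Filter.Eventually.of_forall (hK0 q)), hinner q hq,
      ENNReal.toReal_ofReal (Real.rpow_nonneg (abs_nonneg _) _)]
    exact (hKm.comp measurable_prodMk_left).aestronglyMeasurable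
  -- For a fixed interval the double integral factorises into a square, which is the source of
  -- positivity.
  have h2 : ∀ p, ∫ q, G (q, p) = mixWeight α p * (∫ s, ψ s * e s p) ^ 2 := by
    intro p
    rw [sq, ← integral_prod_mul, ← integral_const_mul]
    congr 1
    ext q
    simp only [hG]
    ring
  have h3 := hGi.integral_prod_right
  rw [h1, integral_integral_swap hGi]
  -- The intervals with `a < 0` and `b > t` contain the whole support of `ψ`, so each of them sees
  -- the full integral of `ψ`.
  have hDm : MeasurableSet (Iio (0 : ℝ) ×ˢ Ioi t) := measurableSet_Iio.prod measurableSet_Ioi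
  have hw : ∫ p in Iio (0 : ℝ) ×ˢ Ioi t, mixWeight α p = t ^ (α - 1) := by
    rw [integral_eq_lintegral_of_nonneg_ae
      (Filter.Eventually.of_forall fun p => mixWeight_nonneg hα' p)
      (measurable_mixWeight α).aestronglyMeasurable, setLIntegral_mixWeight hα' ht, sub_zero,
      ENNReal.toReal_ofReal (Real.rpow_nonneg ht.le _)]
  calc t ^ (α - 1) * (∫ s, ψ s) ^ 2
      = ∫ p in Iio (0 : ℝ) ×ˢ Ioi t, ∫ q, G (q, p) := by
        rw [← hw, ← integral_mul_const]
        refine setIntegral_congr_fun hDm fun p hp => ?_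
        simp only [h2]
        congr 3
        ext s
        by_cases hs : s ∈ Ioc 0 t
        · have : s ∈ Ioo p.1 p.2 := ⟨lt_trans hp.1 hs.1, lt_of_le_of_lt hs.2 hp.2⟩
          simp [he, indicator_of_mem this]
        · simp [hsupp s hs]
    _ ≤ ∫ p, ∫ q, G (q, p) := by
        refine setIntegral_le_integral h3 (Filter.Eventually.of_forall fun p => ?_)
        simp only [h2]
        exact mul_nonneg (mixWeight_nonneg hα' p) (sq_nonneg _)

/-- Coercivity of the fractional integral: a lower bound by the square of the primitive. -/
lemma rpow_mul_sq_integral_le_fracInt {α t : ℝ} (hα : 1 / 2 < α) (hα' : α < 1) (ht : 0 < t)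
    {φ : ℝ → ℝ} (hφ : MemLp φ 2 (volume.restrict (Ioc 0 t))) :
    t ^ (α - 1) * (∫ s in Ioc 0 t, φ s) ^ 2 ≤
      2 * Real.Gamma α * ∫ s in Ioc 0 t, φ s * fracInt α φ s := by
  have hα0 : 0 < α := by linarith
  have hΓ : 0 < Real.Gamma α := Real.Gamma_pos_of_pos hα0
  have hφi : IntegrableOn φ (Ioc 0 t) := hφ.integrable (by norm_num)
  set ψ := (Ioc 0 t).indicator φ with hψ
  have hψi : Integrable ψ := (integrable_indicator_iff measurableSet_Ioc).2 hφi
  set N : ℝ × ℝ → ℝ := fun q => ψ q.1 * (kern α t (q.1 - q.2) * ψ q.2) with hN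
  have hK := integrable_mul_kern hα0 ht.le hφi
  have hNm : AEStronglyMeasurable N (volume.prod volume) := hψi.1.comp_fst.mul hK.1
  have hNi : Integrable N (volume.prod volume) := by
    rw [integrable_prod_iff hNm]
    constructor
    · filter_upwards [hK.prod_right_ae] with s hs
      exact hs.const_mul (ψ s)
    -- Absolute integrability of the energy: `|φ|` and `I^α |φ|` both lie in `L₂`.
    · have hL : MemLp (fracInt α fun s => ‖φ s‖) 2 (volume.restrict (Ioc 0 t)) :=
        memLp_fracInt hα ht.le hφi.norm
      have : Integrable (fun s => ‖φ s‖ * fracInt α (fun s => ‖φ s‖) s)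
          (volume.restrict (Ioc 0 t)) := hφ.norm.integrable_mul hL
      rw [← IntegrableOn, ← integrable_indicator_iff measurableSet_Ioc] at this
      refine this.congr (Filter.Eventually.of_forall fun s => ?_)
      simp only [hN, norm_mul]
      rw [integral_const_mul]
      by_cases hs : s ∈ Ioc 0 t
      · rw [indicator_of_mem hs, fracInt_eq_integral _ hs.1.le hs.2, hψ, indicator_of_mem hs]
        congr 2
        ext r
        rw [Real.norm_of_nonneg (kern_nonneg hα0 _ _), norm_indicator_eq_indicator_norm]
      · rw [indicator_of_notMem hs, hψ, indicator_of_notMem hs]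
        simp
  -- The symmetric kernel is the causal one plus its reflection, which accounts for the factor `2`
  -- in `2Γ(α)`. On the diagonal both sides vanish by the conventions at `0`.
  have hHN : ∀ q : ℝ × ℝ, ψ q.1 * ψ q.2 * |q.1 - q.2| ^ (α - 1) =
      Real.Gamma α * (N q + N q.swap) := by
    rintro ⟨s, r⟩
    simp only [hN, Prod.swap]
    by_cases hs : s ∈ Ioc 0 t
    swap
    · simp [hψ, indicator_of_notMem hs]
    by_cases hr : r ∈ Ioc 0 t
    swap
    · simp [hψ, indicator_of_notMem hr]
    rcases lt_trichotomy s r with h | h | h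
    · have h1 : s - r ∉ Ioc 0 t := fun h' => by linarith [h'.1]
      have h2 : r - s ∈ Ioc 0 t := ⟨by linarith, by linarith [hs.1, hr.2]⟩
      rw [kern, indicator_of_notMem h1, indicator_of_mem h2, omega, abs_sub_comm,
        abs_of_pos h2.1]
      field_simp
      ring
    · simp [h, kern, Real.zero_rpow (show α - 1 ≠ 0 by linarith)]
    · have h1 : r - s ∉ Ioc 0 t := fun h' => by linarith [h'.1]
      have h2 : s - r ∈ Ioc 0 t := ⟨by linarith, by linarith [hr.1, hs.2]⟩
      rw [kern, indicator_of_notMem h1, indicator_of_mem h2, omega, abs_of_pos h2.1]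
      field_simp
      ring
  have hNs : Integrable (fun q : ℝ × ℝ => N q.swap) (volume.prod volume) := hNi.swap
  have hI : ∫ q : ℝ × ℝ, ψ q.1 * ψ q.2 * |q.1 - q.2| ^ (α - 1) =
      2 * Real.Gamma α * ∫ s in Ioc 0 t, φ s * fracInt α φ s := by
    simp_rw [hHN]
    rw [Measure.volume_eq_prod, integral_const_mul, integral_add hNi hNs, integral_prod_swap,
      integral_prod _ hNi, ← integral_indicator measurableSet_Ioc]
    have : ∀ s, ∫ r, N (s, r) = (Ioc 0 t).indicator (fun s => φ s * fracInt α φ s) s := by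
      intro s
      simp only [hN]
      rw [integral_const_mul]
      by_cases hs : s ∈ Ioc 0 t
      · rw [indicator_of_mem hs, fracInt_eq_integral _ hs.1.le hs.2, hψ, indicator_of_mem hs]
      · rw [indicator_of_notMem hs, hψ, indicator_of_notMem hs, zero_mul]
    simp_rw [this]
    ring
  rw [← hI, ← integral_indicator measurableSet_Ioc]
  refine rpow_mul_sq_integral_le hα' ht hψi (fun s hs => indicator_of_notMem hs _) ?_
  exact ((hNi.add hNs).const_mul (Real.Gamma α)).congr
    (Filter.Eventually.of_forall fun q => (hHN q).symm)

/-! ### Bounds for the Gamma function -/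

lemma one_le_Gamma {α : ℝ} (hα : 0 < α) (hα' : α ≤ 1) : 1 ≤ Real.Gamma α := by
  have := Real.Gamma_strictAntiOn_Ioc.antitoneOn ⟨hα, hα'⟩ ⟨one_pos, le_rfl⟩ hα'
  rwa [Real.Gamma_one] at this

/-- `Γ` decreases on `(0,1]`, so `Γ(α) ≤ Γ(1/2) = √π ≤ 2`, while `(1-α)² ≤ 1/4`. -/
lemma two_mul_Gamma_le {α : ℝ} (hα : 1 / 2 < α) (hα' : α < 1) :
    2 * Real.Gamma α ≤ 1 / (1 - α) ^ 2 := by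
  have h1 : Real.Gamma α ≤ 2 := by
    have := Real.Gamma_strictAntiOn_Ioc.antitoneOn ⟨one_half_pos, by norm_num⟩
      ⟨by linarith, hα'.le⟩ hα.le
    rw [Real.Gamma_one_half_eq] at this
    refine this.trans (Real.sqrt_le_iff.2 ⟨by norm_num, ?_⟩)
    linarith [Real.pi_le_four]
  rw [le_div_iff₀ (by nlinarith)]
  nlinarith

/-! ### The `L₂` inner product -/

lemma ip_eq (L : ℝ) (hL : 0 ≤ L) (f g : ℝ → ℝ) : ip L f g = ∫ y, f y * g y ∂(volΩ L) := by
  rw [ip, intervalIntegral.integral_of_le hL, integral_Ioc_eq_integral_Ioo]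

lemma ip_congr {L : ℝ} (hL : 0 ≤ L) {f f' g g' : ℝ → ℝ} (hf : f =ᵐ[volΩ L] f')
    (hg : g =ᵐ[volΩ L] g') : ip L f g = ip L f' g' := by
  rw [ip_eq L hL, ip_eq L hL]
  exact integral_congr_ae (hf.mul hg)

lemma ip_comm (L : ℝ) (f g : ℝ → ℝ) : ip L f g = ip L g f := by
  simp only [ip, mul_comm]

lemma ip_eq_inner {L : ℝ} (hL : 0 ≤ L) {f g : ℝ → ℝ} (hf : MemLp f 2 (volΩ L))
    (hg : MemLp g 2 (volΩ L)) : ip L f g = inner ℝ (hf.toLp f) (hg.toLp g) := by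
  rw [ip_eq L hL, L2.inner_def]
  refine integral_congr_ae ?_
  filter_upwards [hf.coeFn_toLp, hg.coeFn_toLp] with y h1 h2
  rw [h1, h2]
  simp [mul_comm]

lemma ip_add_left {L : ℝ} (hL : 0 ≤ L) {f f' g : ℝ → ℝ} (hf : MemLp f 2 (volΩ L))
    (hf' : MemLp f' 2 (volΩ L)) (hg : MemLp g 2 (volΩ L)) :
    ip L (fun y => f y + f' y) g = ip L f g + ip L f' g := by
  simp only [ip_eq L hL, add_mul]
  exact integral_add (hf.integrable_mul hg) (hf'.integrable_mul hg)

lemma ip_const_mul_left (L c : ℝ) (f g : ℝ → ℝ) :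
    ip L (fun y => c * f y) g = c * ip L f g := by
  simp only [ip, mul_assoc, intervalIntegral.integral_const_mul]

lemma ip_sum_left {L : ℝ} (hL : 0 ≤ L) {ι : Type*} (s : Finset ι) {f : ι → ℝ → ℝ} {g : ℝ → ℝ}
    (c : ι → ℝ) (hf : ∀ i, MemLp (f i) 2 (volΩ L)) (hg : MemLp g 2 (volΩ L)) :
    ip L (fun y => ∑ i ∈ s, c i * f i y) g = ∑ i ∈ s, c i * ip L (f i) g := by
  simp only [ip_eq L hL, Finset.sum_mul, mul_assoc]
  rw [integral_finsetSum]
  · simp only [integral_const_mul]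
  · exact fun i _ => ((hf i).integrable_mul hg).const_mul _

lemma ip_self_nonneg {L : ℝ} (hL : 0 ≤ L) (f : ℝ → ℝ) : 0 ≤ ip L f f := by
  rw [ip_eq L hL]
  exact integral_nonneg fun y => mul_self_nonneg _

lemma sq_ip_le {L : ℝ} (hL : 0 ≤ L) {f g : ℝ → ℝ} (hf : MemLp f 2 (volΩ L))
    (hg : MemLp g 2 (volΩ L)) : ip L f g ^ 2 ≤ ip L f f * ip L g g := by
  rw [ip_eq_inner hL hf hg, ip_eq_inner hL hf hf, ip_eq_inner hL hg hg, sq]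
  exact real_inner_mul_inner_self_le _ _

lemma ip_coe_self {L : ℝ} (hL : 0 ≤ L) (g : Lp ℝ 2 (volΩ L)) : ip L g g = ‖g‖ ^ 2 := by
  rw [ip_eq_inner hL (Lp.memLp g) (Lp.memLp g), Lp.toLp_coeFn, real_inner_self_eq_norm_sq]

/-! ### Finite element functions -/

variable {P : ℕ} {L : ℝ} {x : Fin (P + 1) → ℝ}

lemma IsPartition.exists_mem_Ioo (hx : IsPartition L x) {y : ℝ} (hy : y ∈ Ioo 0 L)
    (hyx : y ∉ range x) : ∃ p : Fin P, y ∈ Ioo (x p.castSucc) (x p.succ) := by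
  have key : ∀ q : Fin (P + 1), y < x q → ∃ p : Fin P, y ∈ Ioo (x p.castSucc) (x p.succ) := by
    intro q
    induction q using Fin.induction with
    | zero => intro h; rw [hx.left] at h; exact absurd hy.1 h.not_gt
    | succ p ih =>
      intro h
      by_cases h' : y < x p.castSucc
      · exact ih h'
      · exact ⟨p, lt_of_le_of_ne (not_lt.1 h') fun e => hyx ⟨_, e⟩, h⟩
  exact key (Fin.last P) (by rw [hx.right]; exact hy.2)

lemma IsPartition.mem_Icc (hx : IsPartition L x) (p : Fin (P + 1)) : x p ∈ Icc 0 L := by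
  rw [← hx.left, ← hx.right]
  exact ⟨hx.strictMono.monotone (Fin.zero_le p), hx.strictMono.monotone (Fin.le_last p)⟩

lemma ae_notMem_range (x : Fin (P + 1) → ℝ) :
    ∀ᵐ y ∂(volΩ L), y ∈ Ioo 0 L ∧ y ∉ range x :=
  (ae_restrict_mem measurableSet_Ioo).and
    (ae_restrict_of_ae ((finite_range x).countable.ae_notMem volume))

lemma IsFEFunction.differentiableAt {v : ℝ → ℝ} (hx : IsPartition L x) (hv : IsFEFunction L x v)
    {y : ℝ} (hy : y ∈ Ioo 0 L) (hyx : y ∉ range x) : DifferentiableAt ℝ v y := by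
  obtain ⟨p, hp⟩ := hx.exists_mem_Ioo hy hyx
  obtain ⟨a, b, hab⟩ := hv.affine p
  have : (fun z => a + b * z) =ᶠ[nhds y] v := by
    filter_upwards [Ioo_mem_nhds hp.1 hp.2] with z hz
    exact (hab z (Ioo_subset_Icc_self hz)).symm
  exact DifferentiableAt.congr_of_eventuallyEq (by fun_prop) this.symm

lemma IsFEFunction.exists_deriv_bound {v : ℝ → ℝ} (hx : IsPartition L x)
    (hv : IsFEFunction L x v) : ∃ C, ∀ y ∈ Ioo 0 L, y ∉ range x → |deriv v y| ≤ C := by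
  choose a b hab using hv.affine
  refine ⟨∑ p, |b p|, fun y hy hyx => ?_⟩
  obtain ⟨p, hp⟩ := hx.exists_mem_Ioo hy hyx
  have : v =ᶠ[nhds y] fun z => a p + b p * z := by
    filter_upwards [Ioo_mem_nhds hp.1 hp.2] with z hz
    exact hab p z (Ioo_subset_Icc_self hz)
  rw [this.deriv_eq]
  have h2 : deriv (fun z => a p + b p * z) y = b p := by
    simp
  rw [h2]
  exact Finset.single_le_sum (f := fun p => |b p|) (fun _ _ => abs_nonneg _) (Finset.mem_univ p)

lemma IsFEFunction.memLp_deriv {v : ℝ → ℝ} (hx : IsPartition L x) (hv : IsFEFunction L x v)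
    (q : ℝ≥0∞) : MemLp (deriv v) q (volΩ L) := by
  obtain ⟨C, hC⟩ := hv.exists_deriv_bound hx
  refine MemLp.of_bound (measurable_deriv v).aestronglyMeasurable C ?_
  filter_upwards [ae_notMem_range x] with y hy using hC y hy.1 hy.2

lemma IsFEFunction.exists_bound {v : ℝ → ℝ} (hv : IsFEFunction L x v) :
    ∃ C, ∀ y ∈ Icc 0 L, |v y| ≤ C :=
  isCompact_Icc.exists_bound_of_continuousOn hv.continuousOn

lemma IsFEFunction.memLp {v : ℝ → ℝ} (hv : IsFEFunction L x v)
    (q : ℝ≥0∞) : MemLp v q (volΩ L) := by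
  obtain ⟨C, hC⟩ := hv.exists_bound
  refine MemLp.of_bound ((hv.continuousOn.mono Ioo_subset_Icc_self).aestronglyMeasurable
    measurableSet_Ioo) C ?_
  filter_upwards [ae_restrict_mem measurableSet_Ioo] with y hy using hC y (Ioo_subset_Icc_self hy)

lemma IsFEFunction.intervalIntegrable_deriv {v : ℝ → ℝ} (hL : 0 ≤ L) (hx : IsPartition L x)
    (hv : IsFEFunction L x v) : IntervalIntegrable (deriv v) volume 0 L := by
  rw [intervalIntegrable_iff_integrableOn_Ioo_of_le hL]
  exact (hv.memLp_deriv hx 1).integrable le_rfl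

lemma IsFEFunction.integral_deriv {v : ℝ → ℝ} (hx : IsPartition L x)
    (hv : IsFEFunction L x v) {a b : ℝ} (ha : 0 ≤ a) (hab : a ≤ b) (hb : b ≤ L) :
    ∫ y in a..b, deriv v y = v b - v a := by
  refine integral_eq_of_hasDerivAt_off_countable v (deriv v) (finite_range x).countable ?_ ?_ ?_
  · rw [uIcc_of_le hab]
    exact hv.continuousOn.mono (Icc_subset_Icc ha hb)
  · rw [min_eq_left hab, max_eq_right hab]
    rintro y ⟨hy, hyx⟩
    exact (hv.differentiableAt hx ⟨ha.trans_lt hy.1, hy.2.trans_le hb⟩ hyx).hasDerivAt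
  · refine (hv.intervalIntegrable_deriv (ha.trans (hab.trans hb)) hx).mono_set ?_
    rw [uIcc_of_le hab, uIcc_of_le (ha.trans (hab.trans hb))]
    exact Icc_subset_Icc ha hb

/-- On `[0,L]` the function is the primitive of its integrable derivative, and its increments agree
with those of the primitive. -/
lemma IsFEFunction.absolutelyContinuous {v : ℝ → ℝ} (hL : 0 ≤ L) (hx : IsPartition L x)
    (hv : IsFEFunction L x v) : AbsolutelyContinuousOnInterval v 0 L := by
  have h := (hv.intervalIntegrable_deriv hL hx).absolutelyContinuousOnInterval_intervalIntegral
    (c := 0) (by rw [uIcc_of_le hL]; exact ⟨le_rfl, hL⟩)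
  rw [absolutelyContinuousOnInterval_iff] at h ⊢
  intro ε hε
  obtain ⟨δ, hδ, h⟩ := h ε hε
  refine ⟨δ, hδ, fun E hE hE' => ?_⟩
  refine lt_of_eq_of_lt (Finset.sum_congr rfl fun i hi => ?_) (h E hE hE')
  have hm := hE.1 i hi
  rw [uIcc_of_le hL] at hm
  rw [hv.integral_deriv hx le_rfl hm.1.1 hm.1.2, hv.integral_deriv hx le_rfl hm.2.1 hm.2.2,
    hv.left, sub_zero, sub_zero]

/-- The Poincaré inequality with constant `L / 2`. -/
lemma IsFEFunction.poincare {v : ℝ → ℝ} (hL : 0 ≤ L) (hx : IsPartition L x)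
    (hv : IsFEFunction L x v) : ip L v v ≤ L ^ 2 / 4 * ip L (deriv v) (deriv v) := by
  have hd := hv.memLp_deriv hx 2
  have hI := hv.intervalIntegrable_deriv hL hx
  set A := ∫ y in (0 : ℝ)..L, |deriv v y| with hA
  have hA2 : A ^ 2 ≤ L * ip L (deriv v) (deriv v) := by
    have h1 : A = ip L (fun y => |deriv v y|) (fun _ => 1) := by simp [hA, ip]
    have h2 := sq_ip_le hL (L := L) hd.abs (memLp_const (1 : ℝ))
    rw [h1]
    refine h2.trans_eq ?_
    have h3 : ip L (fun _ => 1) (fun _ => 1) = L := by simp [ip]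
    rw [h3, mul_comm]
    simp [ip]
  -- Since `v` vanishes at both ends, `|v y|` is bounded by the integral of `|v'|` on either side of
  -- `y`; averaging the two bounds gives `A / 2`, hence the constant `L² / 4`.
  have hpt : ∀ y ∈ Icc 0 L, v y * v y ≤ A ^ 2 / 4 := by
    intro y hy
    have hI1 : IntervalIntegrable (deriv v) volume 0 y := hI.mono_set (by
      rw [uIcc_of_le hy.1, uIcc_of_le hL]; exact Icc_subset_Icc_right hy.2)
    have hI2 : IntervalIntegrable (deriv v) volume y L := hI.mono_set (by
      rw [uIcc_of_le hy.2, uIcc_of_le hL]; exact Icc_subset_Icc_left hy.1)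
    have h1 := hv.integral_deriv hx le_rfl hy.1 hy.2
    have h2 := hv.integral_deriv hx hy.1 hy.2 le_rfl
    rw [hv.left, sub_zero] at h1
    rw [hv.right, zero_sub] at h2
    have h3 := intervalIntegral.abs_integral_le_integral_abs (μ := volume) (f := deriv v) hy.1
    have h4 := intervalIntegral.abs_integral_le_integral_abs (μ := volume) (f := deriv v) hy.2
    have h5 := intervalIntegral.integral_add_adjacent_intervals hI1.abs hI2.abs
    rw [h1] at h3
    rw [h2, abs_neg] at h4
    have h6 : |v y| ≤ A / 2 := by rw [hA, ← h5]; linarith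
    have h7 := pow_le_pow_left₀ (abs_nonneg _) h6 2
    rw [sq_abs] at h7
    nlinarith
  have h1 : ip L v v ≤ L * (A ^ 2 / 4) := by
    have : ip L v v ≤ ∫ _ in (0 : ℝ)..L, A ^ 2 / 4 := by
      refine intervalIntegral.integral_mono_on hL ?_ intervalIntegrable_const hpt
      refine ContinuousOn.intervalIntegrable ?_
      rw [uIcc_of_le hL]
      exact hv.continuousOn.mul hv.continuousOn
    simpa [mul_div_assoc] using this
  nlinarith

/-! ### Functions with nonnegative weak derivative -/

/-- The reflected bump `s ↦ ρ(y - s)` is an admissible test function, because `y` is farther than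
`ρ.rOut` from both ends. The reflection reverses the sign of the derivative. -/
lemma WeakDerivNonneg.convolution_deriv_nonneg {f : ℝ → ℝ} (hL : 0 ≤ L)
    (hf : WeakDerivNonneg L f) (ρ : ContDiffBump (0 : ℝ)) {y : ℝ}
    (hy : y ∈ Ioo ρ.rOut (L - ρ.rOut)) :
    0 ≤ convolution (deriv (ρ.normed volume)) ((Ioo 0 L).indicator f)
      (ContinuousLinearMap.lsmul ℝ ℝ) volume y := by
  set r := ρ.normed volume with hr
  have hrs : ContDiff ℝ ∞ r := ρ.contDiff_normed
  have hsub : HasCompactSupport fun s => r (y - s) :=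
    ρ.hasCompactSupport_normed.comp_homeomorph (Homeomorph.subLeft y)
  have hts : tsupport (fun s => r (y - s)) ⊆ Ioo 0 L := by
    have h1 : (fun s => r (y - s)) = r ∘ (Homeomorph.subLeft y) := rfl
    rw [h1, tsupport_comp_eq_preimage, hr, ρ.tsupport_normed_eq]
    intro s hs
    simp only [mem_preimage, Homeomorph.coe_subLeft, Metric.mem_closedBall, dist_zero_right,
      Real.norm_eq_abs, abs_le] at hs
    exact ⟨by linarith [hy.1], by linarith [hy.2]⟩
  have h : ∫ s in (0 : ℝ)..L, f s * deriv (fun s => r (y - s)) s ≤ 0 :=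
    hf _ (hrs.comp (contDiff_const.sub contDiff_id)) hsub hts fun s => ρ.nonneg_normed _
  simp only [deriv_comp_const_sub, mul_neg, intervalIntegral.integral_neg, neg_nonpos] at h
  rw [intervalIntegral.integral_of_le hL, integral_Ioc_eq_integral_Ioo,
    ← integral_indicator measurableSet_Ioo] at h
  rw [convolution_eq_swap]
  refine h.trans_eq (integral_congr_ae (Filter.Eventually.of_forall fun s => ?_))
  by_cases hs : s ∈ Ioo 0 L
  · simp [indicator_of_mem hs, mul_comm]
  · simp [indicator_of_notMem hs]

lemma norm_convolution_normed_le {f : ℝ → ℝ} {M : ℝ} (hf : ∀ᵐ y, |f y| ≤ M)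
    (ρ : ContDiffBump (0 : ℝ)) (y : ℝ) :
    |convolution (ρ.normed volume) f (ContinuousLinearMap.lsmul ℝ ℝ) volume y| ≤ M := by
  rw [convolution_def, ← Real.norm_eq_abs]
  have h : ∀ᵐ s, |f (y - s)| ≤ M :=
    (quasiMeasurePreserving_sub_left volume y).ae hf
  refine (norm_integral_le_of_norm_le (g := fun s => ρ.normed volume s * M)
    (ρ.integrable_normed.mul_const M) ?_).trans_eq ?_
  · filter_upwards [h] with s hs
    simp only [ContinuousLinearMap.lsmul_apply, smul_eq_mul, norm_mul, Real.norm_eq_abs]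
    rw [abs_of_nonneg (ρ.nonneg_normed s)]
    exact mul_le_mul_of_nonneg_left hs (ρ.nonneg_normed s)
  · rw [integral_mul_const, ρ.integral_normed, one_mul]

/-- A bounded function with nonnegative weak derivative may be tested with the derivative of any
nonnegative absolutely continuous function, up to boundary terms. -/
lemma WeakDerivNonneg.integral_mul_deriv_le {f ψ : ℝ → ℝ} {M η : ℝ} (hL : 0 ≤ L)
    (hf : WeakDerivNonneg L f) (hfm : AEStronglyMeasurable f (volΩ L))
    (hfM : ∀ᵐ y ∂(volΩ L), |f y| ≤ M) (hψ : AbsolutelyContinuousOnInterval ψ 0 L)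
    (hψ0 : ∀ y ∈ Icc 0 L, 0 ≤ ψ y) (hη : 0 < η) (hηL : η ≤ L - η) :
    ∫ y in η..(L - η), f y * deriv ψ y ≤ M * (ψ η + ψ (L - η)) := by
  set F := (Ioo 0 L).indicator f with hF
  have hMae : ∀ᵐ y, |F y| ≤ |M| := by
    rw [ae_restrict_iff' measurableSet_Ioo] at hfM
    filter_upwards [hfM] with y hy
    by_cases h : y ∈ Ioo 0 L
    · rw [hF, indicator_of_mem h]; exact (hy h).trans (le_abs_self M)
    · rw [hF, indicator_of_notMem h]; simp
  have hM0 : 0 ≤ M := by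
    have : (volΩ L) ≠ 0 := by
      rw [Ne, Measure.restrict_eq_zero, Real.volume_Ioo]
      simpa using by linarith
    have : (ae (volΩ L)).NeBot := ae_neBot.2 this
    obtain ⟨y, hy⟩ := hfM.exists
    exact (abs_nonneg _).trans hy
  rw [abs_of_nonneg hM0] at hMae
  have hFi : Integrable F := by
    rw [hF, integrable_indicator_iff measurableSet_Ioo]
    exact (MemLp.of_bound hfm M hfM : MemLp f 1 (volΩ L)).integrable le_rfl
  -- The outer radii stay below `η`, so mollification on `[η, L - η]` never reaches the ends of
  -- `(0,L)`. The fixed ratio `2` of the radii is what the almost everywhere convergence of the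
  -- mollifications requires.
  let ρ : ℕ → ContDiffBump (0 : ℝ) := fun n =>
    ⟨η / (2 * (n + 2)), η / (n + 2), by positivity, by
      rw [div_lt_div_iff_of_pos_left hη (by positivity) (by positivity)]
      linarith [(n.cast_nonneg : (0 : ℝ) ≤ n)]⟩
  have hρ : ∀ n, (ρ n).rOut = η / (n + 2) := fun n => rfl
  have hρη : ∀ n, (ρ n).rOut < η := fun n => by
    rw [hρ, div_lt_iff₀ (by positivity)]
    nlinarith [(n.cast_nonneg : (0 : ℝ) ≤ n)]
  have hlim : Filter.Tendsto (fun n => (ρ n).rOut) Filter.atTop (nhds 0) := by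
    simp only [hρ]
    exact Filter.Tendsto.const_div_atTop
      (Filter.tendsto_atTop_add_const_right _ _ tendsto_natCast_atTop_atTop) _
  have hae := ContDiffBump.ae_convolution_tendsto_right_of_locallyIntegrable (K := 2) hlim
    (Filter.Eventually.of_forall fun n => by
      change η / (n + 2) ≤ 2 * (η / (2 * (n + 2)))
      apply le_of_eq
      field_simp) (hFi.locallyIntegrable)
  set c : ℕ → ℝ → ℝ := fun n =>
    convolution ((ρ n).normed volume) F (ContinuousLinearMap.lsmul ℝ ℝ) volume with hc
  have hcb : ∀ n y, |c n y| ≤ M := fun n y => norm_convolution_normed_le hMae (ρ n) y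
  have hcd : ∀ n, ContDiff ℝ 1 (c n) := fun n =>
    (ρ n).hasCompactSupport_normed.contDiff_convolution_left _ (ρ n).contDiff_normed
      hFi.locallyIntegrable
  have hsub : Icc η (L - η) ⊆ Icc 0 L := Icc_subset_Icc hη.le (by linarith)
  have hψ' : AbsolutelyContinuousOnInterval ψ η (L - η) := hψ.mono (by
    rw [uIcc_of_le hηL, uIcc_of_le hL]; exact hsub)
  -- Integration by parts: the interior term has a sign by monotonicity of the mollified `f`, and
  -- the boundary terms are bounded by `M`.
  have hstep : ∀ n, ∫ y in η..(L - η), c n y * deriv ψ y ≤ M * (ψ η + ψ (L - η)) := by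
    intro n
    rw [((hcd n).contDiffOn.absolutelyContinuousOnInterval).integral_mul_deriv_eq_deriv_mul hψ']
    have h1 : 0 ≤ ∫ y in η..(L - η), deriv (c n) y * ψ y := by
      refine intervalIntegral.integral_nonneg hηL fun y hy => mul_nonneg ?_ (hψ0 y (hsub hy))
      rw [((ρ n).hasCompactSupport_normed.hasDerivAt_convolution_left _
        (ρ n).contDiff_normed hFi.locallyIntegrable y).deriv]
      exact hf.convolution_deriv_nonneg hL (ρ n)
        ⟨(hρη n).trans_le hy.1, by linarith [hρη n, hy.2]⟩
    have h2 := abs_le.1 (hcb n η)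
    have h3 := abs_le.1 (hcb n (L - η))
    have h4 := hψ0 η (hsub ⟨le_rfl, hηL⟩)
    have h5 := hψ0 (L - η) (hsub ⟨hηL, le_rfl⟩)
    nlinarith [mul_le_mul_of_nonneg_right h3.2 h5, mul_le_mul_of_nonneg_right h2.1 h4]
  have hT : Filter.Tendsto (fun n => ∫ y in η..(L - η), c n y * deriv ψ y) Filter.atTop
      (nhds (∫ y in η..(L - η), F y * deriv ψ y)) := by
    refine intervalIntegral.tendsto_integral_filter_of_dominated_convergence
      (fun y => M * |deriv ψ y|) ?_ ?_ ?_ ?_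
    · exact Filter.Eventually.of_forall fun n =>
        (hcd n).continuous.aestronglyMeasurable.mul (measurable_deriv ψ).aestronglyMeasurable
    · refine Filter.Eventually.of_forall fun n => Filter.Eventually.of_forall fun y _ => ?_
      rw [norm_mul]
      exact mul_le_mul_of_nonneg_right (hcb n y) (norm_nonneg _)
    · exact hψ'.intervalIntegrable_deriv.abs.const_mul M
    · filter_upwards [hae] with y hy _
      exact hy.mul_const _
  have hE : ∫ y in η..(L - η), F y * deriv ψ y = ∫ y in η..(L - η), f y * deriv ψ y := by
    refine intervalIntegral.integral_congr fun y hy => ?_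
    rw [uIcc_of_le hηL] at hy
    simp only [hF]
    rw [indicator_of_mem (show y ∈ Ioo 0 L from ⟨hη.trans_le hy.1, by linarith [hy.2]⟩)]
  rw [← hE]
  exact le_of_tendsto hT (Filter.Eventually.of_forall hstep)

/-- Passage to the limit `η → 0` in the preceding estimate: the integral depends continuously on its
endpoints, and the boundary terms tend to zero with `ψ`. -/
lemma WeakDerivNonneg.integral_mul_deriv_nonpos {f ψ : ℝ → ℝ} {M : ℝ} (hL : 0 < L)
    (hf : WeakDerivNonneg L f) (hfm : AEStronglyMeasurable f (volΩ L))
    (hfM : ∀ᵐ y ∂(volΩ L), |f y| ≤ M) (hψ : AbsolutelyContinuousOnInterval ψ 0 L)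
    (hψ0 : ∀ y ∈ Icc 0 L, 0 ≤ ψ y) (h0 : ψ 0 = 0) (h1 : ψ L = 0) :
    ∫ y in (0 : ℝ)..L, f y * deriv ψ y ≤ 0 := by
  have hI : IntervalIntegrable (fun y => f y * deriv ψ y) volume 0 L := by
    have h := hψ.intervalIntegrable_deriv
    rw [intervalIntegrable_iff_integrableOn_Ioo_of_le hL.le] at h ⊢
    exact h.bdd_mul hfm (by simpa using hfM)
  have hc := intervalIntegral.continuousOn_primitive_interval' hI
    (show (0 : ℝ) ∈ uIcc 0 L by simp)
  rw [uIcc_of_le hL.le] at hc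
  have hψc := hψ.continuousOn
  rw [uIcc_of_le hL.le] at hψc
  have hmaps : MapsTo (fun η => L - η) (Icc 0 L) (Icc 0 L) := fun η hη =>
    ⟨by linarith [hη.2], by linarith [hη.1]⟩
  have hrc : ContinuousOn (fun η : ℝ => L - η) (Icc 0 L) := by fun_prop
  have hg : ContinuousOn (fun η => ((∫ y in (0 : ℝ)..(L - η), f y * deriv ψ y) -
      ∫ y in (0 : ℝ)..η, f y * deriv ψ y) - M * (ψ η + ψ (L - η))) (Icc 0 L) :=
    ((hc.comp hrc hmaps).sub hc).sub
      (continuousOn_const.mul (hψc.add (hψc.comp hrc hmaps)))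
  have hlim := (hg 0 ⟨le_rfl, hL.le⟩).mono (show Ioc 0 (L / 2) ⊆ Icc 0 L from fun η hη =>
    ⟨hη.1.le, by linarith [hη.2]⟩)
  have hlim' := hlim.tendsto
  simp only [sub_zero, intervalIntegral.integral_same, h0, h1, add_zero, mul_zero] at hlim'
  have hne : (nhdsWithin (0 : ℝ) (Ioc 0 (L / 2))).NeBot := by
    rw [nhdsWithin_Ioc_eq_nhdsGT (by linarith)]
    infer_instance
  refine le_of_tendsto hlim' ?_
  filter_upwards [self_mem_nhdsWithin] with η hη
  have h2 := hf.integral_mul_deriv_le hL.le hfm hfM hψ hψ0 hη.1 (by linarith [hη.2])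
  have hI1 : IntervalIntegrable (fun y => f y * deriv ψ y) volume 0 η := hI.mono_set (by
    rw [uIcc_of_le hη.1.le, uIcc_of_le hL.le]; exact Icc_subset_Icc_right (by linarith [hη.2]))
  have hI2 : IntervalIntegrable (fun y => f y * deriv ψ y) volume 0 (L - η) := hI.mono_set (by
    rw [uIcc_of_le (by linarith [hη.2]), uIcc_of_le hL.le]
    exact Icc_subset_Icc_right (by linarith [hη.1]))
  rw [intervalIntegral.integral_interval_sub_left hI2 hI1]
  linarith

/-- The convective term has a sign. -/
lemma IsFEFunction.ip_mul_deriv_nonpos {f v : ℝ → ℝ} {M : ℝ} (hL : 0 < L) (hx : IsPartition L x)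
    (hf : WeakDerivNonneg L f) (hfm : AEStronglyMeasurable f (volΩ L))
    (hfM : ∀ᵐ y ∂(volΩ L), |f y| ≤ M) (hv : IsFEFunction L x v) :
    ip L (fun y => f y * v y) (deriv v) ≤ 0 := by
  have hac := hv.absolutelyContinuous hL.le hx
  have h := hf.integral_mul_deriv_nonpos hL hfm hfM (hac.mul hac)
    (fun y _ => mul_self_nonneg (v y)) (by simp [hv.left]) (by simp [hv.right])
  have h2 : ∫ y in (0 : ℝ)..L, f y * deriv (v * v) y =
      2 * ip L (fun y => f y * v y) (deriv v) := by
    rw [ip_eq L hL.le, ← integral_const_mul, intervalIntegral.integral_of_le hL.le,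
      integral_Ioc_eq_integral_Ioo]
    refine integral_congr_ae ?_
    filter_upwards [ae_notMem_range x] with y hy
    have hd := hv.differentiableAt hx hy.1 hy.2
    rw [deriv_mul hd hd]
    ring
  change ∫ y in (0 : ℝ)..L, f y * deriv (v * v) y ≤ 0 at h
  linarith

/-! ### The finite element space as a finite-dimensional vector space -/

lemma IsFEFunction.add {v w : ℝ → ℝ} (hv : IsFEFunction L x v) (hw : IsFEFunction L x w) :
    IsFEFunction L x (v + w) where
  continuousOn := hv.continuousOn.add hw.continuousOn
  affine p := by
    obtain ⟨a, b, h⟩ := hv.affine p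
    obtain ⟨a', b', h'⟩ := hw.affine p
    refine ⟨a + a', b + b', fun y hy => ?_⟩
    rw [Pi.add_apply, h y hy, h' y hy]
    ring
  left := by simp [hv.left, hw.left]
  right := by simp [hv.right, hw.right]

lemma IsFEFunction.const_smul {v : ℝ → ℝ} (hv : IsFEFunction L x v) (c : ℝ) :
    IsFEFunction L x (c • v) where
  continuousOn := hv.continuousOn.const_smul c
  affine p := by
    obtain ⟨a, b, h⟩ := hv.affine p
    refine ⟨c * a, c * b, fun y hy => ?_⟩
    rw [Pi.smul_apply, h y hy, smul_eq_mul]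
    ring
  left := by simp [hv.left]
  right := by simp [hv.right]

lemma isFEFunction_zero : IsFEFunction L x 0 where
  continuousOn := continuousOn_const
  affine _ := ⟨0, 0, by simp⟩
  left := rfl
  right := rfl

lemma isFEFunction_sum {ι : Type*} (s : Finset ι) {b : ι → ℝ → ℝ}
    (hb : ∀ i, IsFEFunction L x (b i)) (c : ι → ℝ) :
    IsFEFunction L x (fun y => ∑ i ∈ s, c i * b i y) := by
  have h : (fun y => ∑ i ∈ s, c i * b i y) = ∑ i ∈ s, c i • b i := by
    ext y
    simp
  rw [h]
  exact Finset.sum_induction _ (IsFEFunction L x) (fun _ _ => IsFEFunction.add)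
    isFEFunction_zero fun i _ => (hb i).const_smul (c i)

lemma IsFEFunction.congr {v w : ℝ → ℝ} (hx : IsPartition L x) (hL : 0 ≤ L)
    (hv : IsFEFunction L x v) (h : ∀ y ∈ Icc 0 L, w y = v y) : IsFEFunction L x w where
  continuousOn := hv.continuousOn.congr h
  affine p := by
    obtain ⟨a, b, hab⟩ := hv.affine p
    refine ⟨a, b, fun y hy => ?_⟩
    rw [h y ⟨(hx.mem_Icc _).1.trans hy.1, hy.2.trans (hx.mem_Icc _).2⟩, hab y hy]
  left := by rw [h 0 ⟨le_rfl, hL⟩, hv.left]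
  right := by rw [h L ⟨hL, le_rfl⟩, hv.right]

/-- A finite element function is determined by its nodal values. -/
lemma IsFEFunction.eq_zero_of_nodes {v : ℝ → ℝ} (hx : IsPartition L x) (hv : IsFEFunction L x v)
    (h : ∀ p, v (x p) = 0) {y : ℝ} (hy : y ∈ Icc 0 L) : v y = 0 := by
  by_cases hyx : y ∈ range x
  · obtain ⟨p, rfl⟩ := hyx
    exact h p
  have h0 : y ≠ 0 := fun e => hyx ⟨0, by rw [hx.left, e]⟩
  have h1 : y ≠ L := fun e => hyx ⟨Fin.last P, by rw [hx.right, e]⟩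
  obtain ⟨p, hp⟩ := hx.exists_mem_Ioo
    ⟨lt_of_le_of_ne hy.1 h0.symm, lt_of_le_of_ne hy.2 h1⟩ hyx
  obtain ⟨a, b, hab⟩ := hv.affine p
  have hlt := hp.1.trans hp.2
  have e1 := hab _ (left_mem_Icc.2 hlt.le)
  have e2 := hab _ (right_mem_Icc.2 hlt.le)
  rw [h] at e1 e2
  have hb : b = 0 := by
    have : b * (x p.succ - x p.castSucc) = 0 := by linarith
    exact (mul_eq_zero.1 this).resolve_right (sub_pos.2 hlt).ne'
  subst hb
  rw [hab y (Ioo_subset_Icc_self hp)]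
  linarith

/-- The finite element functions that vanish outside `[0, L]`, as a vector space. -/
def feSpace (L : ℝ) (x : Fin (P + 1) → ℝ) : Submodule ℝ (ℝ → ℝ) where
  carrier := {v | IsFEFunction L x v ∧ ∀ y, y ∉ Icc 0 L → v y = 0}
  add_mem' hv hw := ⟨hv.1.add hw.1, fun y hy => by simp [hv.2 y hy, hw.2 y hy]⟩
  zero_mem' := ⟨isFEFunction_zero, fun _ _ => rfl⟩
  smul_mem' c v hv := ⟨hv.1.const_smul c, fun y hy => by simp [hv.2 y hy]⟩

/-- Nodal evaluation. -/
def nodalEval (L : ℝ) (x : Fin (P + 1) → ℝ) : feSpace L x →ₗ[ℝ] (Fin (P + 1) → ℝ) where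
  toFun v p := v.1 (x p)
  map_add' _ _ := rfl
  map_smul' _ _ := rfl

/-- The nodes determine the values on `[0,L]`; the convention of vanishing outside turns this into
equality on the whole line. -/
lemma nodalEval_injective (hx : IsPartition L x) : Function.Injective (nodalEval L x) := by
  rw [injective_iff_map_eq_zero]
  rintro ⟨v, hv⟩ h
  ext y
  by_cases hy : y ∈ Icc 0 L
  · exact hv.1.eq_zero_of_nodes hx (fun p => congrFun h p) hy
  · exact hv.2 y hy

lemma linearMap_apply_eq_sum {m n : ℕ} (f : (Fin m → ℝ) →ₗ[ℝ] (Fin n → ℝ)) (c : Fin m → ℝ)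
    (i : Fin n) : f c i = ∑ p, f (Pi.single p 1) i * c p := by
  have h : ∀ p : Fin m, (fun j => if p = j then (1 : ℝ) else 0) = Pi.single p 1 := fun p => by
    ext j
    simp [Pi.single_apply, eq_comm]
  rw [LinearMap.pi_apply_eq_sum_univ f c]
  simp [h, mul_comm]

lemma ip_self_eq_zero {v : ℝ → ℝ} (hL : 0 < L) (hv : IsFEFunction L x v) (h : ip L v v = 0)
    {y : ℝ} (hy : y ∈ Icc 0 L) : v y = 0 := by
  by_contra hne
  have hpos : 0 < ip L v v :=
    intervalIntegral.integral_pos hL (hv.continuousOn.mul hv.continuousOn)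
      (fun z _ => mul_self_nonneg _) ⟨y, hy, mul_self_pos.2 hne⟩
  exact hpos.ne' h

/-- A basis of the finite element space, whose coefficients are recovered linearly from the nodal
values as well as from the moments. -/
lemma exists_feBasis (hL : 0 < L) (hx : IsPartition L x) :
    ∃ (n : ℕ) (b : Fin n → ℝ → ℝ) (A : Fin n → Fin (P + 1) → ℝ) (N : Fin n → Fin n → ℝ),
      (∀ i, IsFEFunction L x (b i)) ∧
      (∀ v, IsFEFunction L x v → ∀ y ∈ Icc 0 L, v y = ∑ i, (∑ p, A i p * v (x p)) * b i y) ∧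
      ∀ c : Fin n → ℝ, ∀ i, c i = ∑ j, N i j * ip L (fun y => ∑ k, c k * b k y) (b j) := by
  have hinj := nodalEval_injective hx
  have hfin : Module.Finite ℝ (feSpace L x) := Module.Finite.of_injective _ hinj
  let B := Module.finBasis ℝ (feSpace L x)
  obtain ⟨G, hG⟩ := (nodalEval L x).exists_leftInverse_of_injective
    (LinearMap.ker_eq_bot.2 hinj)
  have hG' : ∀ v, G (nodalEval L x v) = v := fun v => by
    rw [← LinearMap.comp_apply, hG, LinearMap.id_apply]
  let A := B.equivFun.toLinearMap ∘ₗ G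
  have hb : ∀ i, IsFEFunction L x (B i : ℝ → ℝ) := fun i => (B i).2.1
  have hb2 : ∀ i, MemLp (B i : ℝ → ℝ) 2 (volΩ L) := fun i => (hb i).memLp 2
  have hS : ∀ (c : Fin _ → ℝ) j, ip L (fun y => ∑ k, c k * (B k : ℝ → ℝ) y) (B j) =
      ∑ k, c k * ip L (B k) (B j) := fun c j => ip_sum_left hL.le _ _ hb2 (hb2 j)
  -- The Gram map from coefficients to moments. It is injective because the inner product is
  -- definite on continuous functions; a left inverse supplies `N`.
  let Λ : (Fin _ → ℝ) →ₗ[ℝ] (Fin _ → ℝ) :=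
    { toFun := fun c j => ip L (fun y => ∑ k, c k * (B k : ℝ → ℝ) y) (B j)
      map_add' := fun c d => by
        ext j
        refine (hS _ _).trans ?_
        rw [Pi.add_apply, hS, hS]
        simp only [Pi.add_apply, add_mul, Finset.sum_add_distrib]
      map_smul' := fun r c => by
        ext j
        refine (hS _ _).trans ?_
        rw [Pi.smul_apply, hS]
        simp only [Pi.smul_apply, smul_eq_mul, mul_assoc, Finset.mul_sum, RingHom.id_apply] }
  have hΛ : Function.Injective Λ := by
    rw [injective_iff_map_eq_zero]
    intro c hc
    have hv := isFEFunction_sum Finset.univ hb c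
    have h0 : ip L (fun y => ∑ k, c k * (B k : ℝ → ℝ) y)
        (fun y => ∑ k, c k * (B k : ℝ → ℝ) y) = 0 := by
      rw [ip_sum_left hL.le _ _ hb2 (hv.memLp 2)]
      refine Finset.sum_eq_zero fun j _ => ?_
      rw [ip_comm]
      have : ip L (fun y => ∑ k, c k * (B k : ℝ → ℝ) y) (B j) = 0 := congrFun hc j
      rw [this, mul_zero]
    have hz : ∑ k, c k • B k = 0 := by
      ext y
      by_cases hy : y ∈ Icc 0 L
      · have := ip_self_eq_zero hL hv h0 hy
        simpa using this
      · exact (∑ k, c k • B k).2.2 y hy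
    ext k
    exact Fintype.linearIndependent_iff.1 B.linearIndependent c hz k
  obtain ⟨N, hN⟩ := Λ.exists_leftInverse_of_injective (LinearMap.ker_eq_bot.2 hΛ)
  have hN' : ∀ c, N (Λ c) = c := fun c => by
    rw [← LinearMap.comp_apply, hN, LinearMap.id_apply]
  refine ⟨_, fun i => B i, fun i p => A (Pi.single p 1) i, fun i j => N (Pi.single j 1) i, hb,
    fun v hv y hy => ?_, fun c i => ?_⟩
  · let w : feSpace L x := ⟨(Icc 0 L).indicator v,
      hv.congr hx hL.le fun y hy => indicator_of_mem hy _, fun y hy => indicator_of_notMem hy _⟩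
    have hw : nodalEval L x w = fun p => v (x p) := by
      ext p
      exact indicator_of_mem (hx.mem_Icc p) _
    have h1 : ∀ i, B.repr w i = ∑ p, A (Pi.single p 1) i * v (x p) := fun i => by
      rw [← linearMap_apply_eq_sum A (fun p => v (x p)) i, ← hw]
      simp only [A, LinearMap.comp_apply, hG']
      rfl
    have h2 := congrArg (fun u : feSpace L x => (u : ℝ → ℝ) y) (B.sum_repr w)
    simp only [Submodule.coe_sum, Submodule.coe_smul, Finset.sum_apply, Pi.smul_apply,
      smul_eq_mul, h1] at h2
    rw [h2]
    exact (indicator_of_mem hy _).symm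
  · exact (congrFun (hN' c) i).symm.trans (linearMap_apply_eq_sum N (Λ c) i)

/-! ### The energy inequality at a fixed time -/

/-- The derivative of a linear combination of finite element functions. -/
lemma deriv_fe_sum {ι : Type*} [Fintype ι] {b : ι → ℝ → ℝ} (hx : IsPartition L x)
    (hb : ∀ i, IsFEFunction L x (b i)) (c : ι → ℝ) {y : ℝ} (hy : y ∈ Ioo 0 L)
    (hyx : y ∉ range x) : deriv (fun y => ∑ i, c i * b i y) y = ∑ i, c i * deriv (b i) y := by
  have h := HasDerivAt.fun_sum (u := Finset.univ) fun i _ =>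
    (((hb i).differentiableAt hx hy hyx).hasDerivAt.const_mul (c i))
  exact h.deriv

/-- The energy inequality at a fixed time. -/
lemma energy_inequality {φ Z u0 f : ℝ → ℝ} {CF w : ℝ} (hL : 0 < L) (hx : IsPartition L x)
    (hZ : IsFEFunction L x Z) (hu0 : IsFEFunction L x u0)
    (hfm : AEStronglyMeasurable f (volΩ L)) (hf : WeakDerivNonneg L f)
    (hfCF : ∀ᵐ y ∂(volΩ L), 1 + f y ^ 2 ≤ CF) (G Gs : Lp ℝ 2 (volΩ L))
    (heq : ip L φ Z + ip L (fun y => deriv Z y + w * deriv u0 y) (deriv Z)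
      - ip L (fun y => f y * (Z y + w * u0 y)) (deriv Z) = ip L G Z + ip L Gs (deriv Z)) :
    ip L φ Z ≤ 1 / 4 * L ^ 2 * ‖G‖ ^ 2 + ‖Gs‖ ^ 2 + 1 / 2 * (w ^ 2 * (CF * h1NormSq L u0)) := by
  have hZ2 := hZ.memLp 2
  have hZd := hZ.memLp_deriv hx 2
  have hud := hu0.memLp_deriv hx 2
  have hu2 := hu0.memLp 2
  have hfM : ∀ᵐ y ∂(volΩ L), |f y| ≤ CF := by
    filter_upwards [hfCF] with y hy
    rw [abs_le]
    constructor <;> nlinarith [sq_nonneg (f y - 1), sq_nonneg (f y + 1)]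
  have hf_top : MemLp f ⊤ (volΩ L) := memLp_top_of_bound hfm CF (by simpa using hfM)
  have hfZ : MemLp (fun y => f y * Z y) 2 (volΩ L) := hZ2.mul hf_top
  have hfu : MemLp (fun y => f y * u0 y) 2 (volΩ L) := hu2.mul hf_top
  -- All contributions of the initial value combine into `w ⟨q, Z_x⟩` with `q = u₀ₓ - f u₀`.
  set q : ℝ → ℝ := fun y => deriv u0 y + (-1) * (f y * u0 y) with hq
  have hq2 : MemLp q 2 (volΩ L) := hud.add (hfu.const_mul (-1))
  set D := ip L (deriv Z) (deriv Z) with hD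
  have hD0 : 0 ≤ D := ip_self_nonneg hL.le _
  have e1 : ip L (fun y => deriv Z y + w * deriv u0 y) (deriv Z) =
      D + w * ip L (deriv u0) (deriv Z) := by
    rw [ip_add_left hL.le hZd (hud.const_mul w) hZd, ip_const_mul_left]
  have e2 : ip L (fun y => f y * (Z y + w * u0 y)) (deriv Z) =
      ip L (fun y => f y * Z y) (deriv Z) + w * ip L (fun y => f y * u0 y) (deriv Z) := by
    rw [← ip_const_mul_left, ← ip_add_left hL.le hfZ (hfu.const_mul w) hZd]
    congr 1
    ext y
    ring
  have e3 : ip L q (deriv Z) =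
      ip L (deriv u0) (deriv Z) - ip L (fun y => f y * u0 y) (deriv Z) := by
    rw [hq, ip_add_left hL.le hud (hfu.const_mul (-1)) hZd, ip_const_mul_left]
    ring
  have hsign := hZ.ip_mul_deriv_nonpos hL hx hf hfm hfM
  have hq_le : ip L q q ≤ CF * h1NormSq L u0 := by
    rw [h1NormSq, ip_eq L hL.le, ip_eq L hL.le, ip_eq L hL.le, ← integral_add, ← integral_const_mul]
    · refine integral_mono_ae (hq2.integrable_mul hq2) ?_ ?_
      · exact ((hu2.integrable_mul hu2).add (hud.integrable_mul hud)).const_mul CF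
      · filter_upwards [hfCF] with y hy
        simp only [hq]
        -- Cauchy–Schwarz in the plane: the two sides differ by `(f u₀ₓ + u₀)²`.
        have h1 : (deriv u0 y + -1 * (f y * u0 y)) * (deriv u0 y + -1 * (f y * u0 y)) ≤
            (1 + f y ^ 2) * (u0 y * u0 y + deriv u0 y * deriv u0 y) := by
          nlinarith [sq_nonneg (f y * deriv u0 y + u0 y)]
        refine h1.trans (mul_le_mul_of_nonneg_right hy ?_)
        nlinarith [mul_self_nonneg (u0 y), mul_self_nonneg (deriv u0 y)]
    · exact hu2.integrable_mul hu2
    · exact hud.integrable_mul hud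
  have c1 := sq_ip_le hL.le (Lp.memLp G) hZ2
  have c2 := sq_ip_le hL.le (Lp.memLp Gs) hZd
  have c3 := sq_ip_le hL.le hq2 hZd
  rw [ip_coe_self hL.le] at c1 c2
  have hp := hZ.poincare hL.le hx
  have c1' : ip L G Z ^ 2 ≤ (1 / 4 * L ^ 2 * ‖G‖ ^ 2) * D :=
    c1.trans (by nlinarith [mul_le_mul_of_nonneg_left hp (sq_nonneg ‖G‖)])
  have c3' : (w * ip L q (deriv Z)) ^ 2 ≤ (w ^ 2 * (CF * h1NormSq L u0)) * D := by
    rw [mul_pow, mul_assoc]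
    exact mul_le_mul_of_nonneg_left
      (c3.trans (mul_le_mul_of_nonneg_right hq_le hD0)) (sq_nonneg _)
  have hmain : ip L φ Z + D ≤ ip L G Z + ip L Gs (deriv Z) - w * ip L q (deriv Z) := by
    rw [e1, e2] at heq
    rw [e3]
    linarith
  have hQ0 : 0 ≤ CF * h1NormSq L u0 := (ip_self_nonneg hL.le q).trans hq_le
  have young : ∀ X S κ : ℝ, 0 < κ → 0 ≤ S → X ^ 2 ≤ S * D → X ≤ κ * S + 1 / (4 * κ) * D := by
    intro X S κ hκ hS hX
    have hd : S * D ≤ (κ * S + 1 / (4 * κ) * D) ^ 2 := by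
      have h1 : (κ * S + 1 / (4 * κ) * D) ^ 2 = (κ * S - 1 / (4 * κ) * D) ^ 2 + S * D := by
        field_simp
        ring
      rw [h1]
      exact le_add_of_nonneg_left (sq_nonneg _)
    exact (abs_le_of_sq_le_sq' (hX.trans hd) (by positivity)).2
  -- The parameters `1, 1, 1/2` cost `D/4 + D/4 + D/2 = D`, exactly the dissipation available, and
  -- leave the factor `1/2` on the term in `u₀`.
  have y1 := young _ _ 1 one_pos (by positivity) c1'
  have y2 := young _ _ 1 one_pos (by positivity) c2
  have y3 := young (-(w * ip L q (deriv Z))) (w ^ 2 * (CF * h1NormSq L u0)) (1 / 2) (by norm_num) (by positivity)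
    (by rw [neg_sq]; exact c3')
  norm_num at y1 y2 y3
  linarith

/-! ### Reduction of the Galerkin equation to coefficients -/

lemma absolutelyContinuousOnInterval_sum {ι : Type*} (s : Finset ι) {f : ι → ℝ → ℝ} {a b : ℝ}
    (c : ι → ℝ) (hf : ∀ i, AbsolutelyContinuousOnInterval (f i) a b) :
    AbsolutelyContinuousOnInterval (fun t => ∑ i ∈ s, c i * f i t) a b := by
  have h : (fun t => ∑ i ∈ s, c i * f i t) = ∑ i ∈ s, fun t => c i * f i t := by
    ext t
    simp
  rw [h]
  refine Finset.sum_induction _ (fun f => AbsolutelyContinuousOnInterval f a b)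
    (fun _ _ h h' => h.add h') ?_ fun i _ => (hf i).const_mul (c i)
  have : LipschitzOnWith 0 (0 : ℝ → ℝ) (uIcc a b) := (LipschitzWith.const 0).lipschitzOnWith
  exact this.absolutelyContinuousOnInterval

lemma intervalIntegrable_omega_sub {α : ℝ} (hα : 0 < α) (t : ℝ) :
    IntervalIntegrable (fun s => omega α (t - s)) volume 0 t := by
  simpa using (intervalIntegrable_omega hα t 0).comp_sub_left t

lemma fracInt_sum {α T t : ℝ} {ι : Type*} [Fintype ι] {C : ι → ℝ → ℝ} {f : ℝ → ℝ} {β : ι → ℝ}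
    (hα : 0 < α) (hC : ∀ i, ContinuousOn (C i) (Icc 0 T)) (hf : ∀ s ∈ Icc 0 T,
      f s = ∑ i, C i s * β i) (ht : 0 ≤ t) (htT : t ≤ T) :
    fracInt α f t = ∑ i, fracInt α (C i) t * β i := by
  have hsub : uIcc 0 t ⊆ Icc 0 T := by rw [uIcc_of_le ht]; exact Icc_subset_Icc_right htT
  have h1 : fracInt α f t = ∫ s in (0 : ℝ)..t, ∑ i, omega α (t - s) * C i s * β i := by
    refine intervalIntegral.integral_congr fun s hs => ?_
    rw [hf s (hsub hs), Finset.mul_sum]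
    exact Finset.sum_congr rfl fun i _ => by ring
  rw [h1, intervalIntegral.integral_finsetSum]
  · simp only [intervalIntegral.integral_mul_const, fracInt]
  · exact fun i _ => ((intervalIntegrable_omega_sub hα t).mul_continuousOn
      ((hC i).mono hsub)).mul_const _

lemma rlDeriv_sum {α T t : ℝ} {ι : Type*} [Fintype ι] {C : ι → ℝ → ℝ} {f : ℝ → ℝ} {β d : ι → ℝ}
    (hα : 0 < α) (hC : ∀ i, ContinuousOn (C i) (Icc 0 T)) (hf : ∀ s ∈ Icc 0 T,
      f s = ∑ i, C i s * β i) (ht : t ∈ Ioo 0 T)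
    (hd : ∀ i, HasDerivAt (fracInt α (C i)) (d i) t) :
    rlDeriv α f t = ∑ i, d i * β i := by
  have h := HasDerivAt.fun_sum (u := Finset.univ) fun i _ => (hd i).mul_const (β i)
  refine (h.congr_of_eventuallyEq ?_).deriv
  filter_upwards [Ioo_mem_nhds ht.1 ht.2] with s hs
  exact fracInt_sum hα hC hf hs.1.le hs.2.le

/-- The Galerkin equation at a fixed time for the coefficients with respect to a basis `b`: `c` are
the coefficients of the time derivative, `z` those of its fractional integral, and `w` is the
weight of the initial value `u0`. -/
def ReducedEq {n : ℕ} (L : ℝ) (b : Fin n → ℝ → ℝ) (u0 f : ℝ → ℝ) (w : ℝ) (c z : Fin n → ℝ)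
    (G Gs : Lp ℝ 2 (volΩ L)) (v : ℝ → ℝ) : Prop :=
  ip L (fun y => ∑ i, c i * b i y) v
    + ip L (fun y => deriv (fun y => ∑ i, z i * b i y) y + w * deriv u0 y) (deriv v)
    - ip L (fun y => f y * ((∑ i, z i * b i y) + w * u0 y)) (deriv v)
  = ip L G v + ip L Gs (deriv v)

/-- The coefficients are fixed linear combinations of nodal values, hence absolutely continuous in
time. Their finite number yields one null set of times valid for every `y`. The terms `C i 0 * omega
α t` of the fractional derivatives add up to `ω_α(t) u₀`. -/
lemma IsSemidiscreteSolution.ae_reducedEq {α T : ℝ} {F : ℝ → ℝ → ℝ}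
    {g gs : ℝ → Lp ℝ 2 (volΩ L)} {u0 : ℝ → ℝ} {u : ℝ → ℝ → ℝ} (hα : 0 < α) (hT : 0 < T)
    (hL : 0 < L) (hx : IsPartition L x) (hu0 : IsFEFunction L x u0)
    (hu : IsSemidiscreteSolution α T L x F g gs u0 u) {n : ℕ} {b : Fin n → ℝ → ℝ}
    {A : Fin n → Fin (P + 1) → ℝ} (hb : ∀ i, IsFEFunction L x (b i))
    (hA : ∀ v, IsFEFunction L x v → ∀ y ∈ Icc 0 L,
      v y = ∑ i, (∑ p, A i p * v (x p)) * b i y) :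
    ∀ᵐ t ∂(volume.restrict (Ioo 0 T)), ∀ v, IsFEFunction L x v →
      ReducedEq L b u0 (F t) (omega α t) (fun i => deriv (fun s => ∑ p, A i p * u s (x p)) t)
        (fun i => fracInt α (deriv fun s => ∑ p, A i p * u s (x p)) t) (g t) (gs t) v := by
  set C : Fin n → ℝ → ℝ := fun i s => ∑ p, A i p * u s (x p) with hC
  have hCac : ∀ i, AbsolutelyContinuousOnInterval (C i) 0 T := fun i =>
    absolutelyContinuousOnInterval_sum _ _ fun p => hu.absCont _ (hx.mem_Icc p)
  have hCc : ∀ i, ContinuousOn (C i) (Icc 0 T) := fun i => by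
    have := (hCac i).continuousOn
    rwa [uIcc_of_le hT.le] at this
  have hC0 : ∀ i, C i 0 = ∑ p, A i p * u0 (x p) := fun i => by
    simp only [hC]
    exact Finset.sum_congr rfl fun p _ => by rw [hu.initial _ (hx.mem_Icc p)]
  have hus : ∀ s ∈ Icc 0 T, ∀ y ∈ Icc 0 L, u s y = ∑ i, C i s * b i y := fun s hs y hy =>
    hA _ (hu.mem s hs) y hy
  have hu0s : ∀ y ∈ Icc 0 L, u0 y = ∑ i, C i 0 * b i y := fun y hy => by
    simp only [hC0]
    exact hA _ hu0 y hy
  have hderiv : ∀ (v : ℝ → ℝ) (d : Fin n → ℝ), (∀ y ∈ Icc 0 L, v y = ∑ i, d i * b i y) →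
      ∀ y ∈ Ioo 0 L, y ∉ range x → deriv v y = ∑ i, d i * deriv (b i) y := by
    intro v d hvd y hy hyx
    rw [← deriv_fe_sum hx hb d hy hyx]
    refine Filter.EventuallyEq.deriv_eq ?_
    filter_upwards [Ioo_mem_nhds hy.1 hy.2] with y' hy'
    exact hvd y' (Ioo_subset_Icc_self hy')
  have hdiff : ∀ᵐ t ∂(volume.restrict (Ioo 0 T)), ∀ i, DifferentiableAt ℝ (C i) t := by
    rw [ae_all_iff]
    intro i
    rw [ae_restrict_iff' measurableSet_Ioo]
    filter_upwards [(hCac i).ae_differentiableAt] with t ht htT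
    exact ht (by rw [uIcc_of_le hT.le]; exact Ioo_subset_Icc_self htT)
  have hfrac := ae_all_iff.2 fun i => ae_hasDerivAt_fracInt hα hT.le (hCac i)
  filter_upwards [hu.equation, hdiff, hfrac, ae_restrict_mem measurableSet_Ioo]
    with t heq hd hf ht v hv
  have e1 : (fun y => deriv (fun s => u s y) t) =ᵐ[volΩ L]
      fun y => ∑ i, deriv (C i) t * b i y := by
    filter_upwards [ae_restrict_mem measurableSet_Ioo] with y hy
    have h := HasDerivAt.fun_sum (u := Finset.univ)
      fun i _ => (hd i).hasDerivAt.mul_const (b i y)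
    refine (h.congr_of_eventuallyEq ?_).deriv
    filter_upwards [Ioo_mem_nhds ht.1 ht.2] with s hs
    exact hus s (Ioo_subset_Icc_self hs) y (Ioo_subset_Icc_self hy)
  have e2 : (fun y => rlDeriv α (fun s => deriv (u s) y) t) =ᵐ[volΩ L]
      fun y => deriv (fun y => ∑ i, fracInt α (deriv (C i)) t * b i y) y
        + omega α t * deriv u0 y := by
    filter_upwards [ae_notMem_range x] with y hy
    rw [rlDeriv_sum hα hCc (fun s hs => hderiv _ _ (hus s hs) y hy.1 hy.2) ht hf,
      deriv_fe_sum hx hb _ hy.1 hy.2, hderiv u0 _ hu0s y hy.1 hy.2, Finset.mul_sum,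
      ← Finset.sum_add_distrib]
    exact Finset.sum_congr rfl fun i _ => by ring
  have e3 : (fun y => F t y * rlDeriv α (fun s => u s y) t) =ᵐ[volΩ L]
      fun y => F t y * ((∑ i, fracInt α (deriv (C i)) t * b i y) + omega α t * u0 y) := by
    filter_upwards [ae_restrict_mem measurableSet_Ioo] with y hy
    have hy' := Ioo_subset_Icc_self hy
    rw [rlDeriv_sum hα hCc (fun s hs => hus s hs y hy') ht hf, hu0s y hy']
    congr 1
    rw [Finset.mul_sum, ← Finset.sum_add_distrib]
    exact Finset.sum_congr rfl fun i _ => by ring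
  have h := heq v hv
  rw [ip_congr hL.le e1 (ae_eq_refl v), ip_congr hL.le e2 (ae_eq_refl (deriv v)),
    ip_congr hL.le e3 (ae_eq_refl (deriv v))] at h
  exact h

/-! ### Control of the time derivative by the data -/

lemma abs_ip_mul_le {f h k : ℝ → ℝ} {M : ℝ} (hL : 0 ≤ L)
    (hfM : ∀ᵐ y ∂(volΩ L), |f y| ≤ M) (hh : MemLp h 2 (volΩ L)) (hk : MemLp k 2 (volΩ L)) :
    |ip L (fun y => f y * h y) k| ≤ M * ip L (fun y => |h y|) fun y => |k y| := by
  rw [ip_eq L hL, ip_eq L hL, ← integral_const_mul, ← Real.norm_eq_abs]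
  refine norm_integral_le_of_norm_le ((hh.abs.integrable_mul hk.abs).const_mul M) ?_
  filter_upwards [hfM] with y hy
  rw [norm_mul, norm_mul, mul_assoc]
  exact mul_le_mul_of_nonneg_right hy (by positivity)

lemma abs_ip_coe_le (hL : 0 ≤ L) (G : Lp ℝ 2 (volΩ L)) {k : ℝ → ℝ} (hk : MemLp k 2 (volΩ L)) :
    |ip L G k| ≤ ‖G‖ * Real.sqrt (ip L k k) := by
  have h := sq_ip_le hL (Lp.memLp G) hk
  rw [ip_coe_self hL] at h
  refine abs_le_of_sq_le_sq ?_ (by positivity)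
  rwa [mul_pow, Real.sq_sqrt (ip_self_nonneg hL k)]

/-- The coefficients of the time derivative are controlled by the data and the fractional
integral. -/
lemma exists_abs_coeff_le {n : ℕ} {b : Fin n → ℝ → ℝ} {N : Fin n → Fin n → ℝ} {u0 : ℝ → ℝ}
    (hL : 0 < L) (hx : IsPartition L x) (hu0 : IsFEFunction L x u0)
    (hb : ∀ i, IsFEFunction L x (b i))
    (hN : ∀ c : Fin n → ℝ, ∀ i, c i = ∑ j, N i j * ip L (fun y => ∑ k, c k * b k y) (b j))
    {M : ℝ} (hM : 0 ≤ M) :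
    ∃ K, ∀ (f : ℝ → ℝ) (w : ℝ) (c z : Fin n → ℝ) (G Gs : Lp ℝ 2 (volΩ L)),
      AEStronglyMeasurable f (volΩ L) → (∀ᵐ y ∂(volΩ L), |f y| ≤ M) →
      (∀ j, ReducedEq L b u0 f w c z G Gs (b j)) →
      ∀ i, |c i| ≤ K * ((∑ k, |z k|) + |w| + ‖G‖ + ‖Gs‖) := by
  have hb2 : ∀ i, MemLp (b i) 2 (volΩ L) := fun i => (hb i).memLp 2
  have hbd : ∀ i, MemLp (deriv (b i)) 2 (volΩ L) := fun i => (hb i).memLp_deriv hx 2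
  have hu2 := hu0.memLp 2
  have hud := hu0.memLp_deriv hx 2
  set κ : Fin n → Fin n → ℝ := fun k j =>
    |ip L (deriv (b k)) (deriv (b j))| + M * ip L (fun y => |b k y|) fun y => |deriv (b j) y|
    with hκ
  set κ0 : Fin n → ℝ := fun j =>
    |ip L (deriv u0) (deriv (b j))| + M * ip L (fun y => |u0 y|) fun y => |deriv (b j) y|
    with hκ0
  have hipn : ∀ h k : ℝ → ℝ, 0 ≤ ip L (fun y => |h y|) fun y => |k y| := fun h k => by
    rw [ip_eq L hL.le]
    exact integral_nonneg fun y => by positivity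
  have hκn : ∀ k j, 0 ≤ κ k j := fun k j => by have := hipn (b k) (deriv (b j)); positivity
  have hκ0n : ∀ j, 0 ≤ κ0 j := fun j => by have := hipn u0 (deriv (b j)); positivity
  -- This bound for the `j`th moment involves only `b`, `u0` and `M`, so the resulting constant is
  -- uniform in time.
  set J : Fin n → ℝ := fun j => (∑ k, κ k j) + κ0 j + Real.sqrt (ip L (b j) (b j))
    + Real.sqrt (ip L (deriv (b j)) (deriv (b j))) with hJ
  have hJn : ∀ j, 0 ≤ J j := fun j => by
    have h1 : 0 ≤ ∑ k, κ k j := Finset.sum_nonneg fun k _ => hκn k j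
    have h2 := hκ0n j
    positivity
  refine ⟨∑ i, ∑ j, |N i j| * J j, fun f w c z G Gs hfm hfM heq i => ?_⟩
  set S := (∑ k, |z k|) + |w| + ‖G‖ + ‖Gs‖ with hS
  have hz0 : 0 ≤ ∑ k, |z k| := Finset.sum_nonneg fun k _ => abs_nonneg _
  have hS0 : 0 ≤ S := by positivity
  have hfb : MemLp f ⊤ (volΩ L) := memLp_top_of_bound hfm M (by simpa using hfM)
  have hfb2 : ∀ k, MemLp (fun y => f y * b k y) 2 (volΩ L) := fun k => (hb2 k).mul hfb
  have hfu : MemLp (fun y => f y * u0 y) 2 (volΩ L) := hu2.mul hfb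
  have hsum : ∀ q : Fin n → ℝ → ℝ, (∀ k, MemLp (q k) 2 (volΩ L)) →
      MemLp (fun y => ∑ k, z k * q k y) 2 (volΩ L) := fun q hq =>
    memLp_finsetSum _ fun k _ => (hq k).const_mul (z k)
  have hR : ∀ j, |ip L (fun y => ∑ k, c k * b k y) (b j)| ≤ J j * S := by
    intro j
    have h := heq j
    unfold ReducedEq at h
    have e1 : ip L (fun y => deriv (fun y => ∑ i, z i * b i y) y + w * deriv u0 y)
        (deriv (b j)) = (∑ k, z k * ip L (deriv (b k)) (deriv (b j)))
          + w * ip L (deriv u0) (deriv (b j)) := by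
      rw [← ip_sum_left hL.le _ _ hbd (hbd j), ← ip_const_mul_left,
        ← ip_add_left hL.le (hsum _ hbd) (hud.const_mul w) (hbd j)]
      refine ip_congr hL.le ?_ (ae_eq_refl _)
      filter_upwards [ae_notMem_range x] with y hy
      rw [deriv_fe_sum hx hb _ hy.1 hy.2]
    have e2 : ip L (fun y => f y * ((∑ i, z i * b i y) + w * u0 y)) (deriv (b j)) =
        (∑ k, z k * ip L (fun y => f y * b k y) (deriv (b j)))
          + w * ip L (fun y => f y * u0 y) (deriv (b j)) := by
      rw [← ip_sum_left hL.le _ _ hfb2 (hbd j), ← ip_const_mul_left,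
        ← ip_add_left hL.le (hsum _ hfb2) (hfu.const_mul w) (hbd j)]
      congr 1
      ext y
      rw [mul_add, Finset.mul_sum]
      congr 1
      · exact Finset.sum_congr rfl fun k _ => by ring
      · ring
    rw [e1, e2] at h
    have h' : ip L (fun y => ∑ k, c k * b k y) (b j) =
        (∑ k, z k * (ip L (fun y => f y * b k y) (deriv (b j))
          - ip L (deriv (b k)) (deriv (b j))))
        + w * (ip L (fun y => f y * u0 y) (deriv (b j)) - ip L (deriv u0) (deriv (b j)))
        + ip L G (b j) + ip L Gs (deriv (b j)) := by
      simp only [mul_sub, Finset.sum_sub_distrib]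
      linarith
    have b1 : |∑ k, z k * (ip L (fun y => f y * b k y) (deriv (b j))
        - ip L (deriv (b k)) (deriv (b j)))| ≤ S * ∑ k, κ k j := by
      refine (Finset.abs_sum_le_sum_abs _ _).trans ?_
      rw [Finset.mul_sum]
      refine Finset.sum_le_sum fun k _ => ?_
      rw [abs_mul]
      have hzk : |z k| ≤ S := by
        have := Finset.single_le_sum (f := fun k => |z k|) (fun _ _ => abs_nonneg _)
          (Finset.mem_univ k)
        have h2 : 0 ≤ |w| + ‖G‖ + ‖Gs‖ := by positivity
        linarith
      refine mul_le_mul hzk ?_ (abs_nonneg _) hS0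
      refine (abs_sub _ _).trans ?_
      rw [add_comm]
      exact add_le_add_right (abs_ip_mul_le hL.le hfM (hb2 k) (hbd j)) _
    have b2 : |w * (ip L (fun y => f y * u0 y) (deriv (b j))
        - ip L (deriv u0) (deriv (b j)))| ≤ S * κ0 j := by
      rw [abs_mul]
      refine mul_le_mul ?_ ?_ (abs_nonneg _) hS0
      · have h2 : 0 ≤ ‖G‖ + ‖Gs‖ := by positivity
        linarith
      · refine (abs_sub _ _).trans ?_
        rw [add_comm]
        exact add_le_add_right (abs_ip_mul_le hL.le hfM hu2 (hbd j)) _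
    have b3 : |ip L G (b j)| ≤ S * Real.sqrt (ip L (b j) (b j)) := by
      refine (abs_ip_coe_le hL.le G (hb2 j)).trans
        (mul_le_mul_of_nonneg_right ?_ (Real.sqrt_nonneg _))
      have h2 : 0 ≤ |w| + ‖Gs‖ := by positivity
      linarith
    have b4 : |ip L Gs (deriv (b j))| ≤ S * Real.sqrt (ip L (deriv (b j)) (deriv (b j))) := by
      refine (abs_ip_coe_le hL.le Gs (hbd j)).trans
        (mul_le_mul_of_nonneg_right ?_ (Real.sqrt_nonneg _))
      have h2 : 0 ≤ |w| + ‖G‖ := by positivity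
      linarith
    rw [h']
    refine (abs_add_le _ _).trans ?_
    have t1 := abs_add_le ((∑ k, z k * (ip L (fun y => f y * b k y) (deriv (b j))
          - ip L (deriv (b k)) (deriv (b j))))
        + w * (ip L (fun y => f y * u0 y) (deriv (b j)) - ip L (deriv u0) (deriv (b j))))
        (ip L G (b j))
    have t2 := abs_add_le (∑ k, z k * (ip L (fun y => f y * b k y) (deriv (b j))
          - ip L (deriv (b k)) (deriv (b j))))
        (w * (ip L (fun y => f y * u0 y) (deriv (b j)) - ip L (deriv u0) (deriv (b j))))
    have : J j * S = S * (∑ k, κ k j) + S * κ0 j + S * Real.sqrt (ip L (b j) (b j))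
      + S * Real.sqrt (ip L (deriv (b j)) (deriv (b j))) := by
      simp only [hJ]
      ring
    linarith
  rw [hN c i, Finset.sum_mul]
  refine (Finset.abs_sum_le_sum_abs _ _).trans ?_
  refine le_trans ?_ (Finset.single_le_sum (f := fun i => (∑ j, |N i j| * J j) * S)
    (fun i _ => mul_nonneg (Finset.sum_nonneg fun j _ => mul_nonneg (abs_nonneg _) (hJn j)) hS0)
    (Finset.mem_univ i))
  rw [Finset.sum_mul]
  refine Finset.sum_le_sum fun j _ => ?_
  rw [abs_mul, mul_assoc]
  exact mul_le_mul_of_nonneg_left (hR j) (abs_nonneg _)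

/-! ### Coercivity for functions with values in the finite element space -/

/-- For merely integrable `φ i` the convolution integrand is known to be integrable only for almost
every `s`, hence linearity is asserted almost everywhere. -/
lemma fracInt_sum_of_integrable {α t : ℝ} {ι : Type*} [Fintype ι] {φ : ι → ℝ → ℝ} {β : ι → ℝ}
    (hα : 0 < α) (ht : 0 ≤ t) (hφ : ∀ i, IntegrableOn (φ i) (Ioc 0 t)) :
    ∀ᵐ s ∂(volume.restrict (Ioc 0 t)),
      fracInt α (fun s => ∑ i, φ i s * β i) s = ∑ i, fracInt α (φ i) s * β i := by
  have h := ae_all_iff.2 fun i =>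
    ae_restrict_of_ae (s := Ioc 0 t) (integrable_mul_kern hα ht (hφ i)).prod_right_ae
  filter_upwards [h, ae_restrict_mem measurableSet_Ioc] with s hs hst
  rw [fracInt_eq_integral _ hst.1.le hst.2]
  simp_rw [fracInt_eq_integral _ hst.1.le hst.2, ← integral_mul_const]
  rw [← integral_finsetSum _ fun i _ => (hs i).mul_const (β i)]
  congr 1
  ext r
  by_cases hr : r ∈ Ioc 0 t
  · simp only [indicator_of_mem hr, Finset.mul_sum, mul_assoc]
  · simp [indicator_of_notMem hr]

/-- Coercivity of the fractional integral for functions with values in a finite-dimensional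
function space. -/
lemma ip_sum_le_integral {α t : ℝ} {n : ℕ} {b : Fin n → ℝ → ℝ} {φ : Fin n → ℝ → ℝ}
    (hα : 1 / 2 < α) (hα' : α < 1) (ht : 0 < t) (hL : 0 ≤ L)
    (hb : ∀ i, IsFEFunction L x (b i))
    (hφ : ∀ i, MemLp (φ i) 2 (volume.restrict (Ioc 0 t))) :
    t ^ (α - 1) * ip L (fun y => ∑ i, (∫ s in Ioc 0 t, φ i s) * b i y)
        (fun y => ∑ i, (∫ s in Ioc 0 t, φ i s) * b i y) ≤
      2 * Real.Gamma α * ∫ s in Ioc 0 t, ip L (fun y => ∑ i, φ i s * b i y)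
        (fun y => ∑ i, fracInt α (φ i) s * b i y) := by
  have hα0 : 0 < α := by linarith
  have hφi : ∀ i, IntegrableOn (φ i) (Ioc 0 t) := fun i => (hφ i).integrable (by norm_num)
  have hz : ∀ i, MemLp (fracInt α (φ i)) 2 (volume.restrict (Ioc 0 t)) := fun i =>
    memLp_fracInt hα ht.le (hφi i)
  have hb2 : ∀ i, MemLp (b i) 2 (volΩ L) := fun i => (hb i).memLp 2
  have hφz : ∀ i j, Integrable (fun s => φ i s * fracInt α (φ j) s)
      (volume.restrict (Ioc 0 t)) := fun i j => (hφ i).integrable_mul (hz j)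
  set E : Fin n → Fin n → ℝ := fun i j => ∫ s in Ioc 0 t, φ i s * fracInt α (φ j) s with hE
  -- Scalar coercivity at each fixed `y`, later integrated over `y`. Expansion into the finite
  -- matrix `E` replaces an interchange of the time and space integrals.
  have hpt : ∀ y, t ^ (α - 1) * ((∑ i, (∫ s in Ioc 0 t, φ i s) * b i y) *
      ∑ i, (∫ s in Ioc 0 t, φ i s) * b i y) ≤
      2 * Real.Gamma α * ∑ i, ∑ j, E i j * (b i y * b j y) := by
    intro y
    have hm : MemLp (fun s => ∑ i, φ i s * b i y) 2 (volume.restrict (Ioc 0 t)) :=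
      memLp_finsetSum _ fun i _ => (hφ i).mul_const (b i y)
    have h := rpow_mul_sq_integral_le_fracInt hα hα' ht hm
    have e1 : ∫ s in Ioc 0 t, ∑ i, φ i s * b i y = ∑ i, (∫ s in Ioc 0 t, φ i s) * b i y := by
      rw [integral_finsetSum _ fun i _ => (hφi i).mul_const (b i y)]
      simp only [integral_mul_const]
    have e2 : ∫ s in Ioc 0 t, (∑ i, φ i s * b i y) * fracInt α (fun s => ∑ i, φ i s * b i y) s =
        ∑ i, ∑ j, E i j * (b i y * b j y) := by
      have : ∫ s in Ioc 0 t, (∑ i, φ i s * b i y) * fracInt α (fun s => ∑ i, φ i s * b i y) s =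
          ∫ s in Ioc 0 t, ∑ i, ∑ j, (φ i s * fracInt α (φ j) s) * (b i y * b j y) := by
        refine integral_congr_ae ?_
        filter_upwards [fracInt_sum_of_integrable (β := fun i => b i y) hα0 ht.le hφi] with s hs
        rw [hs, Finset.sum_mul_sum]
        exact Finset.sum_congr rfl fun i _ => Finset.sum_congr rfl fun j _ => by ring
      rw [this, integral_finsetSum _ fun i _ => integrable_finsetSum _ fun j _ =>
        (hφz i j).mul_const (b i y * b j y)]
      refine Finset.sum_congr rfl fun i _ => ?_
      rw [integral_finsetSum _ fun j _ => (hφz i j).mul_const (b i y * b j y)]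
      simp only [integral_mul_const, hE]
    rw [e1, e2, sq] at h
    exact h
  have hbb : ∀ i j, Integrable (fun y => b i y * b j y) (volΩ L) := fun i j =>
    (hb2 i).integrable_mul (hb2 j)
  have hsum2 : ∀ d : Fin n → ℝ, MemLp (fun y => ∑ i, d i * b i y) 2 (volΩ L) := fun d =>
    memLp_finsetSum _ fun i _ => (hb2 i).const_mul (d i)
  have hRi : Integrable (fun y => ∑ i, ∑ j, E i j * (b i y * b j y)) (volΩ L) :=
    integrable_finsetSum _ fun i _ => integrable_finsetSum _ fun j _ => (hbb i j).const_mul _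
  have hR : ∫ y, ∑ i, ∑ j, E i j * (b i y * b j y) ∂(volΩ L) =
      ∑ i, ∑ j, E i j * ip L (b i) (b j) := by
    rw [integral_finsetSum _ fun i _ => integrable_finsetSum _ fun j _ => (hbb i j).const_mul _]
    refine Finset.sum_congr rfl fun i _ => ?_
    rw [integral_finsetSum _ fun j _ => (hbb i j).const_mul _]
    simp only [integral_const_mul, ip_eq L hL]
  have hT : ∫ s in Ioc 0 t, ip L (fun y => ∑ i, φ i s * b i y)
      (fun y => ∑ i, fracInt α (φ i) s * b i y) = ∑ i, ∑ j, E i j * ip L (b i) (b j) := by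
    have : ∀ s, ip L (fun y => ∑ i, φ i s * b i y) (fun y => ∑ i, fracInt α (φ i) s * b i y) =
        ∑ i, ∑ j, (φ i s * fracInt α (φ j) s) * ip L (b i) (b j) := fun s => by
      rw [ip_sum_left hL _ _ hb2 (hsum2 _)]
      refine Finset.sum_congr rfl fun i _ => ?_
      rw [ip_comm, ip_sum_left hL _ _ hb2 (hb2 i), Finset.mul_sum]
      refine Finset.sum_congr rfl fun j _ => ?_
      rw [ip_comm L (b j), mul_assoc]
    simp only [this]
    rw [integral_finsetSum _ fun i _ => integrable_finsetSum _ fun j _ =>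
      (hφz i j).mul_const (ip L (b i) (b j))]
    refine Finset.sum_congr rfl fun i _ => ?_
    rw [integral_finsetSum _ fun j _ => (hφz i j).mul_const (ip L (b i) (b j))]
    simp only [integral_mul_const, hE]
  rw [hT, ← hR, ip_eq L hL, ← integral_const_mul, ← integral_const_mul]
  exact integral_mono_ae (((hsum2 _).integrable_mul (hsum2 _)).const_mul _)
    (hRi.const_mul _) (Filter.Eventually.of_forall hpt)

lemma memLp_norm_of_lintegral_lt_top {E : Type*} [NormedAddCommGroup E] {μ : Measure ℝ}
    {g : ℝ → E} {h : ℝ → ℝ} {c : ℝ} (hc : 0 < c) (hg : AEStronglyMeasurable g μ)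
    (hgh : ∀ s, c * ‖g s‖ ^ 2 ≤ h s) (hfin : ∫⁻ s, ENNReal.ofReal (h s) ∂μ ≠ ⊤) :
    MemLp (fun s => ‖g s‖) 2 μ := by
  refine (memLp_two_iff_integrable_sq hg.norm).2 ?_
  have h1 : Integrable (fun s => c * ‖g s‖ ^ 2) μ := by
    refine ⟨(hg.norm.pow 2).const_mul c, ?_⟩
    rw [HasFiniteIntegral]
    refine lt_of_le_of_lt (lintegral_mono fun s => ?_) hfin.lt_top
    rw [Real.enorm_of_nonneg (by positivity)]
    exact ENNReal.ofReal_le_ofReal (hgh s)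
  have h2 := h1.const_mul c⁻¹
  simpa [← mul_assoc, inv_mul_cancel₀ hc.ne'] using h2

end FracFokkerPlanck

/-! ### Assembly of the stability estimate -/

open FracFokkerPlanck in
theorem theorem3p2 {P : ℕ} (α T L CF : ℝ) (hT : 0 < T) (hL : 0 < L)
    (x : Fin (P + 1) → ℝ) (hx : FracFokkerPlanck.IsPartition L x)
    (F : ℝ → ℝ → ℝ) (hF : FracFokkerPlanck.MemW1InfTime T L F)
    (g gs : ℝ → Lp ℝ 2 (FracFokkerPlanck.volΩ L))
    (hg : Integrable g (volume.restrict (Ioo 0 T)))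
    (hgs : Integrable gs (volume.restrict (Ioo 0 T)))
    (hFx : ∀ᵐ t ∂(volume.restrict (Ioo 0 T)), FracFokkerPlanck.WeakDerivNonneg L (F t))
    (hCF : ∀ᵐ q ∂(FracFokkerPlanck.volQ T L), 1 + F q.1 q.2 ^ 2 ≤ CF)
    (hα : 1 / 2 < α) (hα' : α < 1)
    (u0 : ℝ → ℝ) (hu0 : FracFokkerPlanck.IsFEFunction L x u0)
    (u : ℝ → ℝ → ℝ) (hu : FracFokkerPlanck.IsSemidiscreteSolution α T L x F g gs u0 u)
    (t : ℝ) (ht : 0 < t) (htT : t < T) :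
    ENNReal.ofReal (FracFokkerPlanck.ip L (fun y => u t y - u0 y) (fun y => u t y - u0 y))
      ≤ ENNReal.ofReal (t ^ (1 - α) / (1 - α) ^ 2)
          * (∫⁻ s in Ioo 0 t, ENNReal.ofReal (1 / 4 * L ^ 2 * ‖g s‖ ^ 2 + ‖gs s‖ ^ 2))
        + ENNReal.ofReal (CF * t ^ α / ((1 - α) ^ 2 * (2 * α - 1))
            * FracFokkerPlanck.h1NormSq L u0) := by
  have hα0 : 0 < α := by linarith
  have h1α : 0 < 1 - α := by linarith
  have h2α : 0 < 2 * α - 1 := by linarith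
  have htα : 0 < t ^ (1 - α) := Real.rpow_pos_of_pos ht _
  -- If the data integral is infinite, so is the right-hand side, its prefactor being positive.
  -- Otherwise `g` and `gs` are square integrable on `(0,t)`.
  by_cases hfin : ∫⁻ s in Ioo 0 t, ENNReal.ofReal (1 / 4 * L ^ 2 * ‖g s‖ ^ 2 + ‖gs s‖ ^ 2) = ⊤
  · rw [hfin, ENNReal.mul_top]
    · simp
    · simpa using by positivity
  have hres : volume.restrict (Ioo (0 : ℝ) t) = volume.restrict (Ioc 0 t) :=
    restrict_Ioo_eq_restrict_Ioc
  have hsubT : volume.restrict (Ioc (0 : ℝ) t) ≤ volume.restrict (Ioo 0 T) :=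
    Measure.restrict_mono (Ioc_subset_Ioo_right htT) le_rfl
  rw [hres] at hfin ⊢
  have hgm : AEStronglyMeasurable g (volume.restrict (Ioc 0 t)) := hg.1.mono_measure hsubT
  have hgsm : AEStronglyMeasurable gs (volume.restrict (Ioc 0 t)) := hgs.1.mono_measure hsubT
  have hg2 : MemLp (fun s => ‖g s‖) 2 (volume.restrict (Ioc 0 t)) :=
    memLp_norm_of_lintegral_lt_top (c := 1 / 4 * L ^ 2) (by positivity) hgm
      (fun s => le_add_of_nonneg_right (by positivity)) hfin
  have hgs2 : MemLp (fun s => ‖gs s‖) 2 (volume.restrict (Ioc 0 t)) :=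
    memLp_norm_of_lintegral_lt_top (c := 1) one_pos hgsm
      (fun s => by rw [one_mul]; exact le_add_of_nonneg_left (by positivity)) hfin
  have hI : Integrable (fun s => 1 / 4 * L ^ 2 * ‖g s‖ ^ 2 + ‖gs s‖ ^ 2)
      (volume.restrict (Ioc 0 t)) :=
    (hg2.integrable_sq.const_mul _).add hgs2.integrable_sq
  -- basis expansion of the solution
  obtain ⟨n, b, A, N, hb, hA, hN⟩ := exists_feBasis hL hx
  set C : Fin n → ℝ → ℝ := fun i s => ∑ p, A i p * u s (x p) with hC
  set φ : Fin n → ℝ → ℝ := fun i => deriv (C i) with hφdef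
  have hCac : ∀ i, AbsolutelyContinuousOnInterval (C i) 0 t := fun i =>
    (absolutelyContinuousOnInterval_sum _ _ fun p => hu.absCont _ (hx.mem_Icc p)).mono (by
      rw [uIcc_of_le ht.le, uIcc_of_le hT.le]
      exact Icc_subset_Icc_right htT.le)
  have hφi : ∀ i, IntegrableOn (φ i) (Ioc 0 t) := fun i => by
    rw [← intervalIntegrable_iff_integrableOn_Ioc_of_le ht.le]
    exact (hCac i).intervalIntegrable_deriv
  have hz2 : ∀ i, MemLp (fracInt α (φ i)) 2 (volume.restrict (Ioc 0 t)) := fun i =>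
    memLp_fracInt hα ht.le (hφi i)
  have hFm : ∀ᵐ s ∂(volume.restrict (Ioo 0 T)), AEStronglyMeasurable (F s) (volΩ L) :=
    hF.1.1.prodMk_left
  have hFCF : ∀ᵐ s ∂(volume.restrict (Ioo 0 T)), ∀ᵐ y ∂(volΩ L), 1 + F s y ^ 2 ≤ CF :=
    Measure.ae_ae_of_ae_prod hCF
  have hred := ae_mono hsubT (hu.ae_reducedEq hα0 hT hL hx hu0 hb hA)
  replace hFm := ae_mono hsubT hFm
  replace hFCF := ae_mono hsubT hFCF
  have hFx' := ae_mono hsubT hFx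
  have hFM : ∀ f : ℝ → ℝ, (∀ᵐ y ∂(volΩ L), 1 + f y ^ 2 ≤ CF) →
      ∀ᵐ y ∂(volΩ L), |f y| ≤ |CF| := fun f hf => by
    filter_upwards [hf] with y hy
    refine le_trans ?_ (le_abs_self CF)
    rw [abs_le]
    constructor <;> nlinarith [sq_nonneg (f y - 1), sq_nonneg (f y + 1)]
  -- square integrability of the time derivative
  obtain ⟨K, hK⟩ := exists_abs_coeff_le hL hx hu0 hb hN (abs_nonneg CF)
  -- The bootstrap: every term of the majorant is in `L₂`, since `φ k ∈ L₁` already gives `I^α (φ k)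
  -- ∈ L₂`.
  have hφ2 : ∀ i, MemLp (φ i) 2 (volume.restrict (Ioc 0 t)) := by
    intro i
    have hS : MemLp (fun s => K * ((∑ k, |fracInt α (φ k) s|) + |omega α s| + ‖g s‖ + ‖gs s‖)) 2
        (volume.restrict (Ioc 0 t)) :=
      ((((memLp_finsetSum _ fun k _ => (hz2 k).abs).add (memLp_omega hα ht.le).abs).add
        hg2).add hgs2).const_mul K
    refine hS.mono' (hφi i).aestronglyMeasurable ?_
    filter_upwards [hred, hFm, hFCF] with s h1 h2 h3
    exact hK _ _ _ _ _ _ h2 (hFM _ h3) (fun j => h1 _ (hb j)) i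
  -- the energy inequality
  have henergy : ∀ᵐ s ∂(volume.restrict (Ioc 0 t)),
      ip L (fun y => ∑ i, φ i s * b i y) (fun y => ∑ i, fracInt α (φ i) s * b i y) ≤
        1 / 4 * L ^ 2 * ‖g s‖ ^ 2 + ‖gs s‖ ^ 2
          + 1 / 2 * (omega α s ^ 2 * (CF * h1NormSq L u0)) := by
    filter_upwards [hred, hFm, hFCF, hFx'] with s h1 h2 h3 h4
    have hZ := isFEFunction_sum Finset.univ hb fun i => fracInt α (φ i) s
    exact energy_inequality hL hx hZ hu0 h2 h4 h3 (g s) (gs s) (h1 _ hZ)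
  have hω := integrableOn_omega_sq hα ht.le
  set H := CF * h1NormSq L u0 with hH
  set I := ∫ s in Ioc 0 t, (1 / 4 * L ^ 2 * ‖g s‖ ^ 2 + ‖gs s‖ ^ 2) with hIdef
  have hb2 : ∀ i, MemLp (b i) 2 (volΩ L) := fun i => (hb i).memLp 2
  have hint : ∫ s in Ioc 0 t, ip L (fun y => ∑ i, φ i s * b i y)
      (fun y => ∑ i, fracInt α (φ i) s * b i y) ≤
      I + 1 / 2 * (t ^ (2 * α - 1) / ((2 * α - 1) * Real.Gamma α ^ 2) * H) := by
    rw [← integral_omega_sq hα ht.le, ← integral_mul_const, ← integral_const_mul, hIdef,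
      ← integral_add hI ((hω.mul_const H).const_mul _)]
    refine integral_mono_ae ?_ (hI.add ((hω.mul_const H).const_mul _)) henergy
    have : ∀ s, ip L (fun y => ∑ i, φ i s * b i y) (fun y => ∑ i, fracInt α (φ i) s * b i y) =
        ∑ i, φ i s * ∑ j, fracInt α (φ j) s * ip L (b j) (b i) := fun s => by
      rw [ip_sum_left hL.le _ _ hb2
        (memLp_finsetSum _ fun j _ => (hb2 j).const_mul _)]
      refine Finset.sum_congr rfl fun i _ => ?_
      rw [ip_comm, ip_sum_left hL.le _ _ hb2 (hb2 i)]
    simp only [this]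
    exact integrable_finsetSum _ fun i _ => (hφ2 i).integrable_mul
      (memLp_finsetSum _ fun j _ => (hz2 j).mul_const _)
  have hcoer := ip_sum_le_integral hα hα' ht hL.le hb hφ2
  have hW : ip L (fun y => ∑ i, (∫ s in Ioc 0 t, φ i s) * b i y)
        (fun y => ∑ i, (∫ s in Ioc 0 t, φ i s) * b i y) =
      ip L (fun y => u t y - u0 y) (fun y => u t y - u0 y) := by
    have : ∀ᵐ y ∂(volΩ L), ∑ i, (∫ s in Ioc 0 t, φ i s) * b i y = u t y - u0 y := by
      filter_upwards [ae_restrict_mem measurableSet_Ioo] with y hy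
      have hy' := Ioo_subset_Icc_self hy
      rw [hA _ (hu.mem t ⟨ht.le, htT.le⟩) y hy', hA _ hu0 y hy', ← Finset.sum_sub_distrib]
      refine Finset.sum_congr rfl fun i _ => ?_
      rw [← intervalIntegral.integral_of_le ht.le, (hCac i).integral_deriv_eq_sub, sub_mul]
      simp only [hC, hu.initial _ (hx.mem_Icc _)]
    exact ip_congr hL.le this this
  rw [hW] at hcoer
  set D := ip L (fun y => u t y - u0 y) (fun y => u t y - u0 y) with hD
  have hI0 : 0 ≤ I := integral_nonneg fun s => by positivity
  -- The sign of `CF` is read off at a single point `(s, y)` where `1 + F² ≤ CF` holds; one exists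
  -- because both intervals have positive measure.
  have hH0 : 0 ≤ H := by
    have : (volume.restrict (Ioc (0 : ℝ) t)) ≠ 0 := by
      rw [Ne, Measure.restrict_eq_zero, Real.volume_Ioc]
      simpa using ht
    have : (ae (volume.restrict (Ioc (0 : ℝ) t))).NeBot := ae_neBot.2 this
    obtain ⟨s, hs⟩ := Filter.Eventually.exists hFCF
    have : (volΩ L) ≠ 0 := by
      rw [Ne, Measure.restrict_eq_zero, Real.volume_Ioo]
      simpa using hL
    have : (ae (volΩ L)).NeBot := ae_neBot.2 this
    obtain ⟨y, hy⟩ := hs.exists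
    exact mul_nonneg (by nlinarith [sq_nonneg (F s y)])
      (add_nonneg (ip_self_nonneg hL.le _) (ip_self_nonneg hL.le _))
  have hΓ1 := one_le_Gamma hα0 hα'.le
  have hΓ := two_mul_Gamma_le hα hα'
  have hfinal : D ≤ t ^ (1 - α) / (1 - α) ^ 2 * I
      + CF * t ^ α / ((1 - α) ^ 2 * (2 * α - 1)) * h1NormSq L u0 := by
    set Y := I + t ^ (2 * α - 1) / (2 * α - 1) * H with hY
    have ht2 : 0 < t ^ (2 * α - 1) := Real.rpow_pos_of_pos ht _
    have hY0 : 0 ≤ Y := by positivity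
    -- The factor `1/2` and the denominator `Γ(α)² ≥ 1` are given away here.
    have s1 : I + 1 / 2 * (t ^ (2 * α - 1) / ((2 * α - 1) * Real.Gamma α ^ 2) * H) ≤ Y := by
      have : t ^ (2 * α - 1) / ((2 * α - 1) * Real.Gamma α ^ 2) ≤
          t ^ (2 * α - 1) / (2 * α - 1) := by
        refine div_le_div_of_nonneg_left ht2.le h2α ?_
        exact le_mul_of_one_le_right h2α.le (one_le_pow₀ hΓ1)
      have h3 := mul_le_mul_of_nonneg_right this hH0
      have h4 : 0 ≤ t ^ (2 * α - 1) / ((2 * α - 1) * Real.Gamma α ^ 2) * H := by positivity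
      linarith
    have s2 : t ^ (α - 1) * D ≤ 1 / (1 - α) ^ 2 * Y :=
      hcoer.trans ((mul_le_mul_of_nonneg_left (hint.trans s1) (by positivity)).trans
        (mul_le_mul_of_nonneg_right hΓ hY0))
    have e1 : t ^ (1 - α) * t ^ (α - 1) = 1 := by
      rw [← Real.rpow_add ht]
      simp
    have e2 : t ^ (1 - α) * t ^ (2 * α - 1) = t ^ α := by
      rw [← Real.rpow_add ht]
      congr 1
      ring
    calc D = t ^ (1 - α) * (t ^ (α - 1) * D) := by rw [← mul_assoc, e1, one_mul]
      _ ≤ t ^ (1 - α) * (1 / (1 - α) ^ 2 * Y) := mul_le_mul_of_nonneg_left s2 htα.le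
      _ = _ := by
        rw [hY, hH, ← e2]
        field_simp
  refine (ENNReal.ofReal_le_ofReal hfinal).trans (ENNReal.ofReal_add_le.trans ?_)
  rw [ENNReal.ofReal_mul (by positivity), hIdef, ofReal_integral_eq_lintegral_ofReal hI
    (Filter.Eventually.of_forall fun s => by positivity)]
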